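/- **The game.** Let $R$ be a commutative ring. In the Ideal Chomp Game on $R$ one starts with the ideal $I_0=(0)$; players A and B move alternately, A first. In the $n$-th turn the player to move chooses an element $a_n\in R\setminus I_{n-1}$ and sets $I_n=I_{n-1}+(a_n)$. The player who makes $I_n=R$ loses. A winning strategy for a player is a strategy prescribing a legal move whenever it is that player's turn and such that every game in which the player follows it ends after finitely many moves, with a loss for the opponent. **The algebras.** Let $K$ be a field (for instance an algebraically closed one) and consider the following local $K$-algebras of rank at most $6$, where for all of them except $R_1,R_4,R_{12},R_{13},R_{17}$ a first move $m$ (the class of a polynomial) and a target algebra are listed. (Algebras whose name carries an asterisk need not be distinct, up to isomorphism, from the others.) - $R_1=K$ - $R_{2}=K[x]/(x^2)$; move $x$, target $R_1$ - $R_{3}=K[x]/(x^3)$; move $x$, target $R_1$ - $R_{4}=K[x, y]/(x, y)^2$ - $R_{5}=K[x]/(x^4)$; move $x$, target $R_1$ - $R_{6}=K[x, y]/(x^2, xy, y^3)$; move $y^2$, target $R_{4}$ - $R_{7}=K[x, y]/(x^2, y^2)$; move $xy$, target $R_{4}$ - $R_{7,*}=K[x, y]/(x^2 + y^2, xy)$;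 move $x^2$, target $R_{4}$ - $R_{8}=K[x, y, z]/(x, y, z)^2$; move $z$, target $R_{4}$ - $R_{9}=K[x]/(x^5)$; move $x$, target $R_1$ - $R_{10}=K[x, y]/(x^2, xy, y^4)$; move $y^2$, target $R_{4}$ - $R_{11}=K[x,y]/(x^2 + y^3, xy)$; move $y^2$, target $R_{4}$ - $R_{12}=K[x, y]/(xy, x^3, y^3)$ - $R_{13}=K[x,y]/(x^2, xy^2, y^3)$ - $R_{14}=K[x, y, z]/(x^2, y^2, xy, xz, yz, z^3)$; move $z$, target $R_{4}$ - $R_{15}=K[x, y, z]/(x^2, y^2, z^2, xy, xz)$; move $z$, target $R_{4}$ - $R_{15,*}=K[x, y, z]/(x^2, xy, xz, yz, y^2 + z^2)$; move $z$, target $R_{4}$ - $R_{16}=K[x, y, z]/(xy, xz, yz, x^2 + y^2, x^2 + z^2)$; move $x$, target $R_{4}$ - $R_{17}=K[x, y, z, w]/(x, y, z, w)^2$ - $R_{18}=K[x]/(x^6)$; move $x$, target $R_1$ - $R_{19}=K[x, y]/(x^2, xy, y^5)$; move $y^2$, target $R_{4}$ - $R_{20}=K[x,y]/(x^2+y^4,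 xy)$; move $y^2$, target $R_{4}$ - $R_{21}=K[x, y]/(xy, x^3, y^4)$; move $y^3$, target $R_{12}$ - $R_{22}=K[x,y]/(xy, x^3 + y^3)$; move $x^3$, target $R_{12}$ - $R_{23}=K[x,y]/(x^2, xy^2, y^4)$; move $y^3$, target $R_{13}$ - $R_{24}=K[x,y]/(x^2+y^3, xy^2, y^4)$; move $y^3$, target $R_{13}$ - $R_{25}=K[x,y]/(x^2, y^3)$; move $xy^2$, target $R_{13}$ - $R_{25,*}=K[x,y]/(x^2 + xy^2, y^3)$; move $x^2$, target $R_{13}$ - $R_{25,**}=K[x,y]/(x^2, xy^2 + y^3)$; move $y^3$, target $R_{13}$ - $R_{26}=K[x,y]/(x,y)^3$; move $xy$, target $R_{12}$ - $R_{27}=K[x, y, z]/(x^2, xy, y^2, xz, yz, z^4)$; move $z$, target $R_{4}$ - $R_{28}=K[x,y,z]/(x^2,xy,y^2+z^3, xz, yz, z^4)$; move $z$, target $R_{4}$ - $R_{29}=K[x,y,z]/(x^2, xy + z^3, y^2, xz, yz, z^4)$; move $z$, target $R_{4}$ - $R_{29,*}=K[x,y,z]/(x^2 + z^3, xy, y^2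 + z^3, xz, yz, z^4)$; move $z$, target $R_{4}$ - $R_{30}=K[x, y, z]/(xy, yz, z^2, y^2 - xz, x^3)$; move $x$, target $R_{4}$ - $R_{31}=K[x,y,z]/(xy, z^2, xz - yz, x^2 + y^2 - xz)$; move $x$, target $R_{4}$ - $R_{31,*}=K[x, y, z]/(x^2, z^2, y^2 - xz, yz)$; move $x$, target $R_{4}$ - $R_{32}=K[x,y,z]/(x^2, xy, xz, y^2, yz^2, z^3)$; move $z$, target $R_{4}$ - $R_{33}=K[x,y,z]/(x^2, xy, xz, yz, y^3, z^3)$; move $x$, target $R_{12}$ - $R_{34}=K[x,y,z]/(xy, xz, y^2, z^2, x^3)$; move $x+y$, target $R_{4}$ - $R_{34,*}=K[x,y,z]/(xy, xz, yz, y^2- z^2, x^3)$; move $x+y$, target $R_{4}$ - $R_{35}=K[x,y,z]/(xy, xz, yz, x^2 + y^2 - z^2)$; move $x+y$, target $R_{4}$ - $R_{36}=K[x,y,z]/(x^2, xy, yz, y^2 - z^2)$; move $z$, target $R_{4}$ - $R_{36,*}=K[x,y,z]/(x^2, xy, yz, xz + y^2 - z^2)$; move $z$, target $R_{4}$ - $R_{37}=K[x,y,z]/(x^2,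 xy,y^2, z^2)$; move $z$, target $R_{4}$ - $R_{37,*}=K[x,y,z]/(x^2, xy, y^2, z^2 - xz)$; move $z$, target $R_{4}$ - $R_{38}=K[x, y, z, w]/(x^2, y^2, z^2, xy, xz, xw, yz, yw, zw, w^3)$; move $w^2$, target $R_{17}$ - $R_{39}=K[x,y,z,w]/(x^2, y^2, z^2, w^2, xy, xz, xw, yz, yw)$; move $zw$, target $R_{17}$ - $R_{39,*}=K[x,y,z,w]/(x^2, y^2, z^2 + w^2, xy, xz, xw, yz, yw, zw)$; move $z^2$, target $R_{17}$ - $R_{40}=K[x,y,z,w]/(x^2, y^2 + z^2, y^2 + w^2, xy, xz, xw, yz, yw, zw)$; move $y^2$, target $R_{17}$ - $R_{41}=K[x,y,z,w]/(x^2, y^2, z^2, w^2, xy - zw, xz, xw, yz, yw)$; move $xy$, target $R_{17}$ - $R_{41,*}=K[x,y,z,w]/( x^2 + y^2, x^2 + z^2, x^2+ w^2, xy, xz, xw, yz, yw, zw)$; move $x^2$, target $R_{17}$ - $R_{42}=K[x, y, z, w, v]/(x, y, z, w, v)^2$; move $v$, target $R_{17}$ **Proposition.** Let $R_i$ be one of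 the algebras in this list, with $i\notin\{1,4,12,13,17\}$. Then player A has a winning strategy in the Ideal Chomp Game on $R_i$. More precisely, let $m\in R_i$ be the listed move and $R_j$ the listed target, so that $j\in\{1,4,12,13,17\}$. Then $m\neq 0$, the quotient $R_i/(m)$ is isomorphic to $R_j$ as a $K$-algebra, player B (the second player) has a winning strategy on $R_j$, and player A has a winning strategy on $R_i$ whose first move is $m$. -/

import Mathlib

namespace IdealChomp

/-! ### The game

A finite sequence of moves in a commutative ring is recorded as a list, most recent move first. -/

/-- The two players; player `A` makes the first move. -/
inductive Player
  | A
  | B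

/-- The other player. -/
def Player.opponent : Player → Player
  | .A => .B
  | .B => .A

/-- The player whose turn it is after the moves in `h` have been made. -/
def toMove {R : Type*} (h : List R) : Player :=
  if Even h.length then .A else .B

/-- The ideal generated by the moves made so far. -/
def idealOf {R : Type*} [CommRing R] (h : List R) : Ideal R :=
  Ideal.span {a | a ∈ h}

/-- `h` is a legal sequence of moves: each move lies outside the ideal generated by the earlier
ones. In particular no move can follow once the ideal is the whole ring. -/
def IsLegal {R : Type*} [CommRing R] : List R → Prop
  | [] => True
  | a :: h => IsLegal h ∧ a ∉ idealOf h

/-- The last move of `h` was made by `P` and turned the ideal into the whole ring. For a legal `h`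
this says that the game is over and `P` has lost it. -/
def LostBy {R : Type*} [CommRing R] (P : Player) : List R → Prop
  | [] => False
  | a :: h => toMove h = P ∧ idealOf (a :: h) = ⊤

/-- In `h`, all the moves of player `P` were made according to `σ`. A strategy `σ` prescribes a move
for every history of the game. -/
def Follows {R : Type*} (P : Player) (σ : List R → R) : List R → Prop
  | [] => True
  | a :: h => Follows P σ h ∧ (toMove h = P → a = σ h)

/-- `σ` is a winning strategy for player `P` in the Ideal Chomp Game on `R`. -/
structure IsWinningStrategy {R : Type*} [CommRing R] (P : Player) (σ : List R → R) : Prop where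
  /-- As long as the game is not over, `σ` prescribes legal moves. -/
  legal : ∀ h : List R, IsLegal h → Follows P σ h → idealOf h ≠ ⊤ → toMove h = P →
    σ h ∉ idealOf h
  /-- Every finished game in which `P` follows `σ` is lost by the opponent. -/
  wins : ∀ h : List R, IsLegal h → Follows P σ h → idealOf h = ⊤ → LostBy P.opponent h
  /-- There is no infinite game in which `P` follows `σ`. -/
  ends : ¬ ∃ f : ℕ → List R, f 0 = [] ∧ (∀ n, ∃ a, f (n + 1) = a :: f n) ∧
    ∀ n, IsLegal (f n) ∧ Follows P σ (f n)

/-- Player `P` has a winning strategy in the Ideal Chomp Game on `R`. -/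
def HasWinningStrategy (P : Player) (R : Type*) [CommRing R] : Prop :=
  ∃ σ : List R → R, IsWinningStrategy P σ

/-! ### The table of local algebras -/

/-- The names of the local algebras in the table; `s` and `ss` stand for one and two asterisks. -/
inductive AlgName
  | R1 | R2 | R3 | R4 | R5 | R6 | R7 | R7s | R8 | R9 | R10 | R11 | R12 | R13 | R14 | R15
  | R15s | R16 | R17 | R18 | R19 | R20 | R21 | R22 | R23 | R24 | R25 | R25s | R25ss | R26
  | R27 | R28 | R29 | R29s | R30 | R31 | R31s | R32 | R33 | R34 | R34s | R35 | R36 | R36s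
  | R37 | R37s | R38 | R39 | R39s | R40 | R41 | R41s | R42

/-- A row of the table: an algebra `K[x₁, …, xₙ] / I`, given by `n` and `I`, and, for those algebras
for which a first move is listed, that move and the name of the algebra it leads to. -/
structure Row (K : Type*) [Field K] where
  numVars : ℕ
  ideal : Ideal (MvPolynomial (Fin numVars) K)
  reduction : Option (MvPolynomial (Fin numVars) K × AlgName)

/-- A row whose algebra is presented by 1 variable. -/
noncomputable def row1 {K : Type*} [Field K]
    (f : MvPolynomial (Fin 1) K →
      Ideal (MvPolynomial (Fin 1) K) × Option (MvPolynomial (Fin 1) K × AlgName)) :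
    Row K :=
  ⟨1, (f (.X 0)).1, (f (.X 0)).2⟩

/-- A row whose algebra is presented by 2 variables. -/
noncomputable def row2 {K : Type*} [Field K]
    (f : MvPolynomial (Fin 2) K →
      MvPolynomial (Fin 2) K →
      Ideal (MvPolynomial (Fin 2) K) × Option (MvPolynomial (Fin 2) K × AlgName)) :
    Row K :=
  ⟨2, (f (.X 0) (.X 1)).1, (f (.X 0) (.X 1)).2⟩

/-- A row whose algebra is presented by 3 variables. -/
noncomputable def row3 {K : Type*} [Field K]
    (f : MvPolynomial (Fin 3) K →
      MvPolynomial (Fin 3) K →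
      MvPolynomial (Fin 3) K →
      Ideal (MvPolynomial (Fin 3) K) × Option (MvPolynomial (Fin 3) K × AlgName)) :
    Row K :=
  ⟨3, (f (.X 0) (.X 1) (.X 2)).1, (f (.X 0) (.X 1) (.X 2)).2⟩

/-- A row whose algebra is presented by 4 variables. -/
noncomputable def row4 {K : Type*} [Field K]
    (f : MvPolynomial (Fin 4) K →
      MvPolynomial (Fin 4) K →
      MvPolynomial (Fin 4) K →
      MvPolynomial (Fin 4) K →
      Ideal (MvPolynomial (Fin 4) K) × Option (MvPolynomial (Fin 4) K × AlgName)) :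
    Row K :=
  ⟨4, (f (.X 0) (.X 1) (.X 2) (.X 3)).1, (f (.X 0) (.X 1) (.X 2) (.X 3)).2⟩

/-- A row whose algebra is presented by 5 variables. -/
noncomputable def row5 {K : Type*} [Field K]
    (f : MvPolynomial (Fin 5) K →
      MvPolynomial (Fin 5) K →
      MvPolynomial (Fin 5) K →
      MvPolynomial (Fin 5) K →
      MvPolynomial (Fin 5) K →
      Ideal (MvPolynomial (Fin 5) K) × Option (MvPolynomial (Fin 5) K × AlgName)) :
    Row K :=
  ⟨5, (f (.X 0) (.X 1) (.X 2) (.X 3) (.X 4)).1, (f (.X 0) (.X 1) (.X 2) (.X 3) (.X 4)).2⟩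

/-- The local algebras of rank at most 6, together with the listed first moves. The algebra `R1` is
`K` itself, presented as the polynomial ring in no variables. -/
noncomputable def table (K : Type*) [Field K] : AlgName → Row K
  | .R1 => ⟨0, ⊥, none⟩
  | .R2 => row1 fun x => (Ideal.span {x ^ 2}, some (x, .R1))
  | .R3 => row1 fun x => (Ideal.span {x ^ 3}, some (x, .R1))
  | .R4 => row2 fun x y => (Ideal.span {x, y} ^ 2, none)
  | .R5 => row1 fun x => (Ideal.span {x ^ 4}, some (x, .R1))
  | .R6 => row2 fun x y => (Ideal.span {x ^ 2, x * y, y ^ 3}, some (y ^ 2, .R4))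
  | .R7 => row2 fun x y => (Ideal.span {x ^ 2, y ^ 2}, some (x * y, .R4))
  | .R7s => row2 fun x y => (Ideal.span {x ^ 2 + y ^ 2, x * y}, some (x ^ 2, .R4))
  | .R8 => row3 fun x y z => (Ideal.span {x, y, z} ^ 2, some (z, .R4))
  | .R9 => row1 fun x => (Ideal.span {x ^ 5}, some (x, .R1))
  | .R10 => row2 fun x y => (Ideal.span {x ^ 2, x * y, y ^ 4}, some (y ^ 2, .R4))
  | .R11 => row2 fun x y => (Ideal.span {x ^ 2 + y ^ 3, x * y}, some (y ^ 2, .R4))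
  | .R12 => row2 fun x y => (Ideal.span {x * y, x ^ 3, y ^ 3}, none)
  | .R13 => row2 fun x y => (Ideal.span {x ^ 2, x * y ^ 2, y ^ 3}, none)
  | .R14 => row3 fun x y z => (Ideal.span {x ^ 2, y ^ 2, x * y, x * z, y * z, z ^ 3}, some (z, .R4))
  | .R15 => row3 fun x y z => (Ideal.span {x ^ 2, y ^ 2, z ^ 2, x * y, x * z}, some (z, .R4))
  | .R15s => row3 fun x y z =>
      (Ideal.span {x ^ 2, x * y, x * z, y * z, y ^ 2 + z ^ 2}, some (z, .R4))
  | .R16 => row3 fun x y z =>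
      (Ideal.span {x * y, x * z, y * z, x ^ 2 + y ^ 2, x ^ 2 + z ^ 2}, some (x, .R4))
  | .R17 => row4 fun x y z w => (Ideal.span {x, y, z, w} ^ 2, none)
  | .R18 => row1 fun x => (Ideal.span {x ^ 6}, some (x, .R1))
  | .R19 => row2 fun x y => (Ideal.span {x ^ 2, x * y, y ^ 5}, some (y ^ 2, .R4))
  | .R20 => row2 fun x y => (Ideal.span {x ^ 2 + y ^ 4, x * y}, some (y ^ 2, .R4))
  | .R21 => row2 fun x y => (Ideal.span {x * y, x ^ 3, y ^ 4}, some (y ^ 3, .R12))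
  | .R22 => row2 fun x y => (Ideal.span {x * y, x ^ 3 + y ^ 3}, some (x ^ 3, .R12))
  | .R23 => row2 fun x y => (Ideal.span {x ^ 2, x * y ^ 2, y ^ 4}, some (y ^ 3, .R13))
  | .R24 => row2 fun x y => (Ideal.span {x ^ 2 + y ^ 3, x * y ^ 2, y ^ 4}, some (y ^ 3, .R13))
  | .R25 => row2 fun x y => (Ideal.span {x ^ 2, y ^ 3}, some (x * y ^ 2, .R13))
  | .R25s => row2 fun x y => (Ideal.span {x ^ 2 + x * y ^ 2, y ^ 3}, some (x ^ 2, .R13))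
  | .R25ss => row2 fun x y => (Ideal.span {x ^ 2, x * y ^ 2 + y ^ 3}, some (y ^ 3, .R13))
  | .R26 => row2 fun x y => (Ideal.span {x, y} ^ 3, some (x * y, .R12))
  | .R27 => row3 fun x y z => (Ideal.span {x ^ 2, x * y, y ^ 2, x * z, y * z, z ^ 4}, some (z, .R4))
  | .R28 => row3 fun x y z =>
      (Ideal.span {x ^ 2, x * y, y ^ 2 + z ^ 3, x * z, y * z, z ^ 4}, some (z, .R4))
  | .R29 => row3 fun x y z =>
      (Ideal.span {x ^ 2, x * y + z ^ 3, y ^ 2, x * z, y * z, z ^ 4}, some (z, .R4))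
  | .R29s => row3 fun x y z =>
      (Ideal.span {x ^ 2 + z ^ 3, x * y, y ^ 2 + z ^ 3, x * z, y * z, z ^ 4}, some (z, .R4))
  | .R30 => row3 fun x y z =>
      (Ideal.span {x * y, y * z, z ^ 2, y ^ 2 - x * z, x ^ 3}, some (x, .R4))
  | .R31 => row3 fun x y z =>
      (Ideal.span {x * y, z ^ 2, x * z - y * z, x ^ 2 + y ^ 2 - x * z}, some (x, .R4))
  | .R31s => row3 fun x y z => (Ideal.span {x ^ 2, z ^ 2, y ^ 2 - x * z, y * z}, some (x, .R4))
  | .R32 => row3 fun x y z =>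
      (Ideal.span {x ^ 2, x * y, x * z, y ^ 2, y * z ^ 2, z ^ 3}, some (z, .R4))
  | .R33 => row3 fun x y z =>
      (Ideal.span {x ^ 2, x * y, x * z, y * z, y ^ 3, z ^ 3}, some (x, .R12))
  | .R34 => row3 fun x y z => (Ideal.span {x * y, x * z, y ^ 2, z ^ 2, x ^ 3}, some (x + y, .R4))
  | .R34s => row3 fun x y z =>
      (Ideal.span {x * y, x * z, y * z, y ^ 2 - z ^ 2, x ^ 3}, some (x + y, .R4))
  | .R35 => row3 fun x y z =>
      (Ideal.span {x * y, x * z, y * z, x ^ 2 + y ^ 2 - z ^ 2}, some (x + y, .R4))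
  | .R36 => row3 fun x y z => (Ideal.span {x ^ 2, x * y, y * z, y ^ 2 - z ^ 2}, some (z, .R4))
  | .R36s => row3 fun x y z =>
      (Ideal.span {x ^ 2, x * y, y * z, x * z + y ^ 2 - z ^ 2}, some (z, .R4))
  | .R37 => row3 fun x y z => (Ideal.span {x ^ 2, x * y, y ^ 2, z ^ 2}, some (z, .R4))
  | .R37s => row3 fun x y z => (Ideal.span {x ^ 2, x * y, y ^ 2, z ^ 2 - x * z}, some (z, .R4))
  | .R38 => row4 fun x y z w =>
      (Ideal.span {x ^ 2, y ^ 2, z ^ 2, x * y, x * z, x * w, y * z, y * w, z * w, w ^ 3},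
        some (w ^ 2, .R17))
  | .R39 => row4 fun x y z w =>
      (Ideal.span {x ^ 2, y ^ 2, z ^ 2, w ^ 2, x * y, x * z, x * w, y * z, y * w},
        some (z * w, .R17))
  | .R39s => row4 fun x y z w =>
      (Ideal.span {x ^ 2, y ^ 2, z ^ 2 + w ^ 2, x * y, x * z, x * w, y * z, y * w, z * w},
        some (z ^ 2, .R17))
  | .R40 => row4 fun x y z w =>
      (Ideal.span {x ^ 2, y ^ 2 + z ^ 2, y ^ 2 + w ^ 2, x * y, x * z, x * w, y * z, y * w, z * w},
        some (y ^ 2, .R17))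
  | .R41 => row4 fun x y z w =>
      (Ideal.span {x ^ 2, y ^ 2, z ^ 2, w ^ 2, x * y - z * w, x * z, x * w, y * z, y * w},
        some (x * y, .R17))
  | .R41s => row4 fun x y z w =>
      (Ideal.span {x ^ 2 + y ^ 2, x ^ 2 + z ^ 2, x ^ 2 + w ^ 2, x * y, x * z, x * w,
          y * z, y * w, z * w},
        some (x ^ 2, .R17))
  | .R42 => row5 fun x y z w v => (Ideal.span {x, y, z, w, v} ^ 2, some (v, .R17))

/-- The polynomial ring of which the algebra named `i` is a quotient. -/
abbrev Poly (K : Type*) [Field K] (i : AlgName) : Type _ :=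
  MvPolynomial (Fin (table K i).numVars) K

/-- The local algebra named `i`. -/
abbrev Alg (K : Type*) [Field K] (i : AlgName) : Type _ :=
  Poly K i ⧸ (table K i).ideal

/-- The class of the polynomial `m` in the algebra named `i`. -/
noncomputable abbrev cls (K : Type*) [Field K] (i : AlgName) (m : Poly K i) : Alg K i :=
  Ideal.Quotient.mk (table K i).ideal m

end IdealChomp

namespace IdealChomp

/-! Call an ideal lost (`Losing`) if every proper move from it has an answer leading to a lost ideal
again. In a Noetherian ring games terminate, so B wins if the zero ideal is lost, and A wins by
opening with any nonzero `m` for which `(m)` is lost. Being lost passes in both directions along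
surjections, hence depends only on the quotient ring. It is therefore enough to show that the five
targets are lost at zero, and that each listed `m` is nonzero with quotient isomorphic to its
target.

Targets. Let `M` be a maximal ideal with residue field `K`. If `M ^ 2 ≤ I ≤ M`, every proper move
lowers the codimension by exactly one, and so parity decides (`losing_of_odd_finrank`). This settles
`R1`, `R4`, `R17`, of ranks 1, 3, 5. `R12` and `R13` have Hilbert function 1, 2, 2
(`losing_of_finrank_eq_five`): a move inside `M ^ 2` is answered by filling up `M ^ 2`, of
codimension 3, and a move outside it by a second generator of `M`, which leaves exactly `M`.

Reductions. Isomorphisms of presented algebras come from substitutions checked on solutions in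
arbitrary `K`-algebras, which turns ideal membership into equational reasoning
(`nonempty_algEquiv_of_converts`). That `m` is nonzero is certified by a linear functional vanishing
on the ideal but not at `m` (`eq_zero_of_mem_span`); dual families of such functionals also give the
dimensions of the targets (`finrank_quotient_span`). -/

theorem toMove_cons {R : Type*} (a : R) (h : List R) : toMove (a :: h) = (toMove h).opponent := by
  by_cases hh : Even h.length <;> simp [toMove, hh, Player.opponent, Nat.even_add_one]

theorem opponent_eq_iff (P Q : Player) : P.opponent = Q ↔ P ≠ Q := by
  cases P <;> cases Q <;> simp [Player.opponent]

theorem eq_opponent_iff (P Q : Player) : P = Q.opponent ↔ P ≠ Q := by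
  cases P <;> cases Q <;> simp [Player.opponent]

/-! ### Lost positions -/

/-- The ideals from which the player to move loses: every proper legal move `a` has a proper
answer `resp a` leading to such an ideal again. -/
inductive Losing {R : Type*} [CommRing R] : Ideal R → Prop
  | mk (I : Ideal R) (hI : I ≠ ⊤) (resp : R → R)
      (hresp : ∀ a ∉ I, I ⊔ Ideal.span {a} ≠ ⊤ → resp a ∉ I ⊔ Ideal.span {a})
      (hlos : ∀ a ∉ I, I ⊔ Ideal.span {a} ≠ ⊤ →
        Losing (I ⊔ Ideal.span {a} ⊔ Ideal.span {resp a})) : Losing I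

section Game

variable {R : Type*} [CommRing R]

theorem Losing.ne_top {I : Ideal R} (h : Losing I) : I ≠ ⊤ := by
  cases h; assumption

theorem Losing.exists_answer {I : Ideal R} (h : Losing I) {a : R} (ha : a ∉ I)
    (ht : I ⊔ Ideal.span {a} ≠ ⊤) :
    ∃ b, b ∉ I ⊔ Ideal.span {a} ∧ Losing (I ⊔ Ideal.span {a} ⊔ Ideal.span {b}) := by
  obtain ⟨_, _, resp, h1, h2⟩ := h
  exact ⟨resp a, h1 a ha ht, h2 a ha ht⟩

/-- Choice collects the individual answers into the response function that the constructor asks for.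
-/
theorem Losing.of_exists {I : Ideal R} (hI : I ≠ ⊤)
    (h : ∀ a ∉ I, I ⊔ Ideal.span {a} ≠ ⊤ →
      ∃ b, b ∉ I ⊔ Ideal.span {a} ∧ Losing (I ⊔ Ideal.span {a} ⊔ Ideal.span {b})) :
    Losing I := by
  choose! r h1 h2 using h
  exact .mk I hI r h1 h2

/-- This matches one move upstairs with one move downstairs; surjectivity is needed to lift the
coefficient of `f a`. -/
theorem comap_sup_span {S : Type*} [CommRing S] (f : R →+* S) (hf : Function.Surjective f)
    (I : Ideal S) (a : R) :
    (I ⊔ Ideal.span {f a}).comap f = I.comap f ⊔ Ideal.span {a} := by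
  apply le_antisymm
  · intro x hx
    rw [Ideal.mem_comap, sup_comm] at hx
    obtain ⟨c, i, hi, hc⟩ := Ideal.mem_span_singleton_sup.1 hx
    obtain ⟨c, rfl⟩ := hf c
    rw [sup_comm]
    refine Ideal.mem_span_singleton_sup.2 ⟨c, x - c * a, ?_, by ring⟩
    rw [Ideal.mem_comap, map_sub, map_mul, ← hc]
    simpa using hi
  · refine sup_le (Ideal.comap_mono le_sup_left) ?_
    rw [Ideal.span_singleton_le_iff_mem, Ideal.mem_comap]
    exact Ideal.mem_sup_right (Ideal.mem_span_singleton_self _)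

/-- All ideals reached from `I.comap f` contain the kernel, so the game above it is the game above
`I` with moves lifted along `f`. -/
theorem Losing.comap {S : Type*} [CommRing S] (f : R →+* S) (hf : Function.Surjective f)
    {I : Ideal S} (h : Losing I) : Losing (I.comap f) := by
  induction h with
  | mk I hI r h1 _ ih =>
    refine .of_exists (by simpa using hI) fun a ha ht => ?_
    rw [← comap_sup_span f hf] at ht ⊢
    have ht' : I ⊔ Ideal.span {f a} ≠ ⊤ := by simpa using ht
    obtain ⟨b, hb⟩ := hf (r (f a))
    refine ⟨b, ?_, ?_⟩
    · rw [Ideal.mem_comap, hb]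
      exact h1 _ ha ht'
    · rw [← comap_sup_span f hf, hb]
      exact ih _ ha ht'

theorem Losing.of_comap {S : Type*} [CommRing S] (f : R →+* S) (hf : Function.Surjective f)
    {I : Ideal S} (h : Losing (I.comap f)) : Losing I := by
  -- The induction runs over ideals of `R`, so the pulled-back ideal must first become a variable.
  generalize hJ : I.comap f = J at h
  induction h generalizing I with
  | mk J hJt r h1 _ ih =>
    subst hJ
    refine .of_exists (by simpa using hJt) fun a ha ht => ?_
    obtain ⟨a, rfl⟩ := hf a
    have ht' : I.comap f ⊔ Ideal.span {a} ≠ ⊤ := by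
      rw [← comap_sup_span f hf]; simpa using ht
    refine ⟨f (r a), fun hb => h1 a ha ht' ?_, ih a ha ht' ?_⟩
    · rw [← comap_sup_span f hf]; exact hb
    · rw [comap_sup_span f hf, comap_sup_span f hf]

/-! ### From lost positions to strategies -/

theorem idealOf_nil : idealOf ([] : List R) = ⊥ := by
  simp [idealOf]

theorem idealOf_cons (a : R) (h : List R) : idealOf (a :: h) = idealOf h ⊔ Ideal.span {a} := by
  rw [idealOf, idealOf, ← Ideal.span_union]
  congr 1
  ext b
  simp

/-- In the position `h`, the move `b` is legal and leaves a lost position to the other player. -/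
def IsGoodMove (h : List R) (b : R) : Prop :=
  b ∉ idealOf h ∧ Losing (idealOf (b :: h))

/-- The two halves feed each other along the history: a lost position turns any proper opposing move
into one with a good reply, and a good reply restores a lost position. Only the empty history needs
separate input, which depends on who starts. -/
theorem invariant_of_follows {P : Player} {σ : List R → R}
    (hσ : ∀ h, (∃ b, IsGoodMove h b) → IsGoodMove h (σ h))
    (hA : P = .A → IsGoodMove [] (σ []))
    (hB : P = .B → Losing (⊥ : Ideal R)) (h : List R) (hl : IsLegal h) (hf : Follows P σ h) :
    (toMove h = P → idealOf h ≠ ⊤ → IsGoodMove h (σ h)) ∧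
      (toMove h ≠ P → Losing (idealOf h)) := by
  induction h with
  | nil =>
    refine ⟨fun h _ => hA (by rw [← h]; simp [toMove]), fun h => ?_⟩
    rw [idealOf_nil]
    refine hB ?_
    cases P
    · simp [toMove] at h
    · rfl
  | cons a t ih =>
    obtain ⟨ih1, ih2⟩ := ih hl.1 hf.1
    have hm : toMove (a :: t) ≠ P ↔ toMove t = P := by
      rw [toMove_cons, Ne, opponent_eq_iff, not_not]
    rw [hm, toMove_cons, opponent_eq_iff]
    refine ⟨fun h ht => hσ _ ?_, fun h => ?_⟩
    · rw [idealOf_cons] at ht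
      obtain ⟨b, h1, h2⟩ := (ih2 h).exists_answer hl.2 ht
      exact ⟨b, by rwa [idealOf_cons], by rwa [idealOf_cons, idealOf_cons]⟩
    · rw [hf.2 h]
      -- A legal move exists after `t`, so the ideal there is still proper.
      exact (ih1 h fun ht => hl.2 (by simp [ht])).2

theorem isWinningStrategy_of_isGoodMove [IsNoetherianRing R] {P : Player} {σ : List R → R}
    (hσ : ∀ h, (∃ b, IsGoodMove h b) → IsGoodMove h (σ h))
    (hA : P = .A → IsGoodMove [] (σ []))
    (hB : P = .B → Losing (⊥ : Ideal R)) : IsWinningStrategy P σ where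
  legal h hl hf ht hm := ((invariant_of_follows hσ hA hB h hl hf).1 hm ht).1
  wins h hl hf ht := by
    -- Positions left by `P` are lost, hence proper; a finished game must have been ended by the
    -- opponent.
    have hm : toMove h = P := by
      by_contra hm
      exact ((invariant_of_follows hσ hA hB h hl hf).2 hm).ne_top ht
    cases h with
    | nil =>
      have hP : P = .A := by rw [← hm]; simp [toMove]
      -- The empty history is finished only in the zero ring, where no good opening exists.
      have h1 := hA hP
      refine absurd (top_le_iff.1 ?_) h1.2.ne_top
      rw [idealOf_cons, ht]
      exact le_sup_left
    | cons a t =>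
      refine ⟨?_, ht⟩
      rw [toMove_cons, opponent_eq_iff] at hm
      rwa [eq_opponent_iff]
  ends := by
    rintro ⟨f, -, hf, hl⟩
    -- An infinite legal game would be a strictly ascending chain of ideals.
    refine not_strictMono_of_wellFoundedGT (fun n => idealOf (f n)) (strictMono_nat_of_lt_succ ?_)
    intro n
    obtain ⟨a, ha⟩ := hf n
    have h1 := (hl (n + 1)).1
    rw [ha] at h1
    simp only [ha, idealOf_cons]
    refine lt_of_le_of_ne le_sup_left fun h => h1.2 ?_
    rw [h]
    exact Ideal.mem_sup_right (Ideal.mem_span_singleton_self _)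

theorem hasWinningStrategy_B [IsNoetherianRing R] (h : Losing (⊥ : Ideal R)) :
    HasWinningStrategy .B R := by
  classical
  -- The default 0 is harmless: nothing is required of it where no good move exists.
  refine ⟨fun h => if hb : ∃ b, IsGoodMove h b then hb.choose else 0,
    isWinningStrategy_of_isGoodMove (fun h hb => ?_) (fun h => by simp at h) fun _ => h⟩
  simp only [hb, dif_pos]
  exact hb.choose_spec

theorem exists_winningStrategy_A [IsNoetherianRing R] {m : R} (hm : m ≠ 0)
    (h : Losing (Ideal.span {m})) :
    ∃ σ : List R → R, IsWinningStrategy .A σ ∧ σ [] = m := by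
  classical
  have hgood : IsGoodMove [] m :=
    ⟨by simpa [idealOf_nil] using hm, by simpa [idealOf_cons, idealOf_nil] using h⟩
  -- Choice might pick another good opening, so `m` is prescribed explicitly at the empty history.
  refine ⟨fun h => if h = [] then m else if hb : ∃ b, IsGoodMove h b then hb.choose else 0,
    isWinningStrategy_of_isGoodMove (fun h hb => ?_) (fun _ => by simpa using hgood)
      (fun h => by simp at h), by simp⟩
  by_cases hh : h = []
  · subst hh
    simpa using hgood
  · simp only [hh, if_false, hb, dif_pos]
    exact hb.choose_spec

end Game

/-! ### Lost positions in algebras over a field -/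

section Algebra

variable {K A : Type*} [Field K] [CommRing A] [Algebra K A]

theorem exists_sub_algebraMap_mem {M : Ideal A} (hM : Module.finrank K (A ⧸ M) = 1) (a : A) :
    ∃ c : K, a - algebraMap K A c ∈ M := by
  have : Nontrivial (A ⧸ M) := Module.nontrivial_of_finrank_pos (R := K) (by omega)
  obtain ⟨c, hc⟩ := (finrank_eq_one_iff_of_nonzero' (1 : A ⧸ M) one_ne_zero).1 hM
    (Ideal.Quotient.mk M a)
  refine ⟨c, Ideal.Quotient.eq.1 ?_⟩
  rw [← hc, Algebra.smul_def, mul_one]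
  rfl

theorem sup_span_eq_top_of_notMem {M : Ideal A} (hM : Module.finrank K (A ⧸ M) = 1) {a : A}
    (ha : a ∉ M) : M ⊔ Ideal.span {a} = ⊤ := by
  obtain ⟨c, hc⟩ := exists_sub_algebraMap_mem hM a
  have hc0 : c ≠ 0 := by
    rintro rfl
    exact ha (by simpa using hc)
  refine Ideal.eq_top_of_isUnit_mem _ (x := algebraMap K A c) ?_ (hc0.isUnit.map _)
  rw [← sub_sub_cancel a (algebraMap K A c)]
  exact Ideal.sub_mem _ (Ideal.mem_sup_right (Ideal.mem_span_singleton_self a))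
    (Ideal.mem_sup_left hc)

/-- An element outside the maximal ideal `M` is coprime to `M`, hence to `M ^ k`, so playing it
would end the game. -/
theorem mem_of_sup_span_ne_top {M I : Ideal A} (hM : Module.finrank K (A ⧸ M) = 1) {k : ℕ}
    (hI : M ^ k ≤ I) {a : A} (ht : I ⊔ Ideal.span {a} ≠ ⊤) : a ∈ M := by
  by_contra ha
  refine ht (top_le_iff.1 ?_)
  have h : IsCoprime M (Ideal.span {a}) :=
    Ideal.isCoprime_iff_sup_eq.2 (sup_span_eq_top_of_notMem hM ha)
  rw [← Ideal.isCoprime_iff_sup_eq.1 (h.pow_left (m := k))]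
  exact sup_le_sup_right hI _

theorem finite_quotient_of_le {I J : Ideal A} (h : I ≤ J) [Module.Finite K (A ⧸ I)] :
    Module.Finite K (A ⧸ J) :=
  Module.Finite.of_surjective (Ideal.Quotient.factorₐ K h).toLinearMap
    (Ideal.Quotient.factor_surjective h)

theorem eq_of_le_of_finrank_eq {I J : Ideal A} (h : I ≤ J) [Module.Finite K (A ⧸ I)]
    (hf : Module.finrank K (A ⧸ I) = Module.finrank K (A ⧸ J)) : I = J := by
  have := finite_quotient_of_le (K := K) h
  refine le_antisymm h fun x hx => ?_
  have hinj := (LinearMap.injective_iff_surjective_of_finrank_eq_finrank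
    (f := (Ideal.Quotient.factorₐ K h).toLinearMap) hf).2 (Ideal.Quotient.factor_surjective h)
  refine Ideal.Quotient.eq_zero_iff_mem.1 (hinj ?_)
  rw [map_zero]
  exact Ideal.Quotient.eq_zero_iff_mem.2 hx

/-- Since `A = K + M` and `M` multiplies `a` into `I`, the kernel of `A ⧸ I → A ⧸ (I + (a))` is the
line spanned by `a`. -/
theorem finrank_quotient_sup_span {M I : Ideal A} (hM : Module.finrank K (A ⧸ M) = 1)
    [Module.Finite K (A ⧸ I)] {a : A} (ha : a ∉ I) (hMa : ∀ c ∈ M, c * a ∈ I) :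
    Module.finrank K (A ⧸ (I ⊔ Ideal.span {a})) + 1 = Module.finrank K (A ⧸ I) := by
  have hle : I ≤ I ⊔ Ideal.span {a} := le_sup_left
  set q := (Ideal.Quotient.factorₐ K hle).toLinearMap with hq
  have hker : LinearMap.ker q = K ∙ (Ideal.Quotient.mk I a) := by
    ext x
    obtain ⟨x, rfl⟩ := Ideal.Quotient.mk_surjective x
    rw [LinearMap.mem_ker, Submodule.mem_span_singleton]
    have : q (Ideal.Quotient.mk I x) = Ideal.Quotient.mk (I ⊔ Ideal.span {a}) x := rfl
    rw [this, Ideal.Quotient.eq_zero_iff_mem]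
    constructor
    · intro hx
      rw [sup_comm] at hx
      obtain ⟨d, i, hi, rfl⟩ := Ideal.mem_span_singleton_sup.1 hx
      obtain ⟨c, hc⟩ := exists_sub_algebraMap_mem hM d
      refine ⟨c, Ideal.Quotient.eq.2 (?_ : c • a - (d * a + i) ∈ I)⟩
      have : c • a - (d * a + i) = - ((d - algebraMap K A c) * a + i) := by
        rw [Algebra.smul_def]; ring
      rw [this]
      exact I.neg_mem (I.add_mem (hMa _ hc) hi)
    · rintro ⟨c, hc⟩
      have hc : c • a - x ∈ I := Ideal.Quotient.eq.1 hc
      rw [← Ideal.neg_mem_iff, ← sub_sub_cancel_left (c • a), ]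
      refine Ideal.sub_mem _ (Ideal.mem_sup_left hc) (Ideal.mem_sup_right ?_)
      rw [Algebra.smul_def]
      exact Ideal.mul_mem_left _ _ (Ideal.mem_span_singleton_self a)
  have h := LinearMap.finrank_range_add_finrank_ker q
  rw [LinearMap.range_eq_top.2 (Ideal.Quotient.factor_surjective hle), finrank_top, hker,
    finrank_span_singleton (by rwa [Ne, Ideal.Quotient.eq_zero_iff_mem])] at h
  exact h

theorem exists_mem_notMem_of_finrank_ne {I J : Ideal A} (h : I ≤ J)
    (hf : Module.finrank K (A ⧸ I) ≠ Module.finrank K (A ⧸ J)) : ∃ b ∈ J, b ∉ I := by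
  by_contra! hb
  exact hf (by rw [le_antisymm h hb])

/-- If `M` is a maximal ideal with residue field `K`, then an ideal of odd codimension between
`M ^ 2` and `M` is lost: every move lowers the codimension by one. -/
theorem losing_of_odd_finrank {M I : Ideal A} (hM : Module.finrank K (A ⧸ M) = 1)
    (hMI : M ^ 2 ≤ I) (hIM : I ≤ M) [Module.Finite K (A ⧸ I)]
    (hodd : Odd (Module.finrank K (A ⧸ I))) : Losing I := by
  induction hd : Module.finrank K (A ⧸ I) using Nat.strong_induction_on generalizing I with
  | _ d ih =>
    subst hd
    have hstep (L : Ideal A) (hL : M ^ 2 ≤ L) {a : A} (ha : a ∈ M) : ∀ c ∈ M, c * a ∈ L :=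
      fun c hc => hL (by rw [pow_two]; exact Ideal.mul_mem_mul hc ha)
    have hne : I ≠ ⊤ := by
      rintro rfl
      simp [Module.finrank_zero_of_subsingleton] at hodd
    refine .of_exists hne fun a ha ht => ?_
    have haM := mem_of_sup_span_ne_top hM hMI ht
    have h1 := finrank_quotient_sup_span hM ha (hstep I hMI haM)
    have hIa : I ⊔ Ideal.span {a} ≤ M := sup_le hIM ((Ideal.span_singleton_le_iff_mem _).2 haM)
    -- The codimension is now even while that of `M` is 1, so there is room left inside `M`.
    obtain ⟨b, hbM, hb⟩ := exists_mem_notMem_of_finrank_ne (K := K) hIa (by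
      rw [hM]
      intro h
      rw [← h1, h] at hodd
      exact absurd hodd (by decide))
    have hMI' : M ^ 2 ≤ I ⊔ Ideal.span {a} := hMI.trans le_sup_left
    have hf := finite_quotient_of_le (K := K) (le_sup_left : I ≤ I ⊔ Ideal.span {a})
    have h2 := finrank_quotient_sup_span hM hb (hstep _ hMI' hbM)
    have hf' := finite_quotient_of_le (K := K)
      (le_sup_left : I ⊔ Ideal.span {a} ≤ I ⊔ Ideal.span {a} ⊔ Ideal.span {b})
    refine ⟨b, hb, ih _ (by omega) (hMI'.trans le_sup_left)
      (sup_le hIa ((Ideal.span_singleton_le_iff_mem _).2 hbM)) ?_ rfl⟩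
    rw [← h1, ← h2] at hodd
    rw [Nat.odd_iff] at hodd ⊢
    omega

/-- Ideals with Hilbert function `1, 2, 2` at a maximal ideal `M` with residue field `K` are
lost. -/
theorem losing_of_finrank_eq_five {M J : Ideal A} (hM : Module.finrank K (A ⧸ M) = 1)
    (hM2 : Module.finrank K (A ⧸ M ^ 2) = 3) (hMJ : M ^ 3 ≤ J) (hJM : J ≤ M ^ 2)
    [Module.Finite K (A ⧸ J)] (hJ : Module.finrank K (A ⧸ J) = 5) : Losing J := by
  have hfM2 := finite_quotient_of_le (K := K) hJM
  have hM2M : M ^ 2 ≤ M := Ideal.pow_le_self two_ne_zero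
  have hfM := finite_quotient_of_le (K := K) hM2M
  have hne : J ≠ ⊤ := by
    rintro rfl
    simp [Module.finrank_zero_of_subsingleton] at hJ
  refine .of_exists hne fun a ha ht => ?_
  have haM := mem_of_sup_span_ne_top hM hMJ ht
  have hfa := finite_quotient_of_le (K := K) (le_sup_left : J ≤ J ⊔ Ideal.span {a})
  by_cases ha2 : a ∈ M ^ 2
  · have hstep (L : Ideal A) (hL : M ^ 3 ≤ L) {a : A} (ha : a ∈ M ^ 2) : ∀ c ∈ M, c * a ∈ L :=
      fun c hc => hL (by rw [pow_succ']; exact Ideal.mul_mem_mul hc ha)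
    have h1 := finrank_quotient_sup_span hM ha (hstep J hMJ ha2)
    have hJa : J ⊔ Ideal.span {a} ≤ M ^ 2 :=
      sup_le hJM ((Ideal.span_singleton_le_iff_mem _).2 ha2)
    -- Codimensions 4 and 3: one more element of `M ^ 2` fills it up.
    obtain ⟨b, hbM, hb⟩ := exists_mem_notMem_of_finrank_ne (K := K) hJa (by omega)
    have h2 := finrank_quotient_sup_span hM hb (hstep _ (hMJ.trans le_sup_left) hbM)
    have hf' := finite_quotient_of_le (K := K)
      (le_sup_left : J ⊔ Ideal.span {a} ≤ J ⊔ Ideal.span {a} ⊔ Ideal.span {b})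
    refine ⟨b, hb, ?_⟩
    rw [eq_of_le_of_finrank_eq (K := K)
      (sup_le hJa ((Ideal.span_singleton_le_iff_mem _).2 hbM)) (by omega)]
    exact losing_of_odd_finrank hM le_rfl hM2M (by rw [hM2]; decide)
  · have hstep (L : Ideal A) (hL : M ^ 2 ≤ L) {a : A} (ha : a ∈ M) : ∀ c ∈ M, c * a ∈ L :=
      fun c hc => hL (by rw [pow_two]; exact Ideal.mul_mem_mul hc ha)
    -- Modulo `M ^ 2` the ideal `M` is two-dimensional and `a` is nonzero there; the answer `b`
    -- completes `a` to a basis.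
    have h1 := finrank_quotient_sup_span hM ha2 (hstep _ le_rfl haM)
    have hIa : M ^ 2 ⊔ Ideal.span {a} ≤ M :=
      sup_le hM2M ((Ideal.span_singleton_le_iff_mem _).2 haM)
    have hfI := finite_quotient_of_le (K := K) (le_sup_left : M ^ 2 ≤ M ^ 2 ⊔ Ideal.span {a})
    obtain ⟨b, hbM, hb⟩ := exists_mem_notMem_of_finrank_ne (K := K) hIa (by omega)
    have h2 := finrank_quotient_sup_span hM hb (hstep _ le_sup_left hbM)
    have hf' := finite_quotient_of_le (K := K)
      (le_sup_left : M ^ 2 ⊔ Ideal.span {a} ≤ M ^ 2 ⊔ Ideal.span {a} ⊔ Ideal.span {b})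
    have hgen : M ^ 2 ⊔ Ideal.span {a} ⊔ Ideal.span {b} = M :=
      eq_of_le_of_finrank_eq (K := K)
        (sup_le hIa ((Ideal.span_singleton_le_iff_mem _).2 hbM)) (by omega)
    refine ⟨b, fun h => hb (sup_le_sup_right hJM _ h), ?_⟩
    set L := J ⊔ Ideal.span {a} ⊔ Ideal.span {b} with hL
    have hJL : J ≤ L := le_sup_left.trans le_sup_left
    have hgen' : M ≤ M ^ 2 ⊔ L := by
      conv_lhs => rw [← hgen]
      exact sup_le (sup_le le_sup_left (le_sup_right.trans le_sup_left |>.trans le_sup_right))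
        (le_sup_right.trans le_sup_right)
    -- A Nakayama-type step: `M = M ^ 2 + L` gives `M ^ 2 ≤ M ^ 3 + M * L`, and `M ^ 3` already lies
    -- in `J ≤ L`.
    have hM2L : M ^ 2 ≤ L := by
      calc M ^ 2 = M * M := pow_two M
        _ ≤ M * (M ^ 2 ⊔ L) := Ideal.mul_mono_right hgen'
        _ = M ^ 3 ⊔ M * L := by rw [Ideal.mul_sup, ← pow_succ']
        _ ≤ L := sup_le (hMJ.trans hJL) Ideal.mul_le_right
    have hLM : L = M := by
      refine le_antisymm ?_ (hgen'.trans (sup_le hM2L le_rfl))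
      exact sup_le (sup_le (hJM.trans hM2M) ((Ideal.span_singleton_le_iff_mem _).2 haM))
        ((Ideal.span_singleton_le_iff_mem _).2 hbM)
    rw [hLM]
    exact losing_of_odd_finrank hM hM2M le_rfl (by rw [hM]; decide)

end Algebra

/-! ### Presented algebras -/

section Presentation

open MvPolynomial

universe u

variable {K : Type u} [Field K] {n p : ℕ}

/-- The values `y` satisfy the relations in `S`. -/
def Satisfies {B : Type u} [CommRing B] [Algebra K B] (S : Set (MvPolynomial (Fin n) K))
    (y : Fin n → B) : Prop :=
  ∀ s ∈ S, aeval y s = 0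

theorem aeval_mk_X (I : Ideal (MvPolynomial (Fin n) K)) :
    aeval (fun i => Ideal.Quotient.mk I (X i)) = Ideal.Quotient.mkₐ K I :=
  (aeval_unique (Ideal.Quotient.mkₐ K I)).symm

theorem satisfies_mk_X (S : Set (MvPolynomial (Fin n) K)) :
    Satisfies S (fun i => Ideal.Quotient.mk (Ideal.span S) (X i)) := by
  intro s hs
  rw [aeval_mk_X]
  exact Ideal.Quotient.eq_zero_iff_mem.2 (Ideal.subset_span hs)

/-- The classes of the variables in the quotient form a generic solution. Testing algebras in
universe `u` suffices because this quotient lives there. -/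
theorem mem_span_of_satisfies {S : Set (MvPolynomial (Fin n) K)} {q : MvPolynomial (Fin n) K}
    (h : ∀ (B : Type u) [CommRing B] [Algebra K B] (y : Fin n → B),
      Satisfies S y → aeval y q = 0) : q ∈ Ideal.span S := by
  have := h _ _ (satisfies_mk_X S)
  rw [aeval_mk_X] at this
  exact Ideal.Quotient.eq_zero_iff_mem.1 this

/-- Rewriting variables by `f` turns solutions of `T` into solutions of `S`, and `g` undoes it. -/
def Converts (S : Set (MvPolynomial (Fin n) K)) (T : Set (MvPolynomial (Fin p) K))
    (f : Fin n → MvPolynomial (Fin p) K) (g : Fin p → MvPolynomial (Fin n) K) : Prop :=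
  ∀ (B : Type u) [CommRing B] [Algebra K B] (y : Fin p → B), Satisfies T y →
    Satisfies S (fun i => aeval y (f i)) ∧ ∀ i, aeval (fun i => aeval y (f i)) (g i) = y i

/-- The algebra map between presented algebras given by a change of variables. -/
noncomputable def presentedMap (S : Set (MvPolynomial (Fin n) K))
    (T : Set (MvPolynomial (Fin p) K)) (f : Fin n → MvPolynomial (Fin p) K)
    (h : ∀ s ∈ S, aeval f s ∈ Ideal.span T) :
    (MvPolynomial (Fin n) K ⧸ Ideal.span S) →ₐ[K] (MvPolynomial (Fin p) K ⧸ Ideal.span T) :=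
  Ideal.Quotient.liftₐ (Ideal.span S) ((Ideal.Quotient.mkₐ K (Ideal.span T)).comp (aeval f)) (by
    change Ideal.span S ≤ RingHom.ker _
    rw [Ideal.span_le]
    exact fun s hs => Ideal.Quotient.eq_zero_iff_mem.2 (h s hs))

theorem presentedMap_mk (S : Set (MvPolynomial (Fin n) K))
    (T : Set (MvPolynomial (Fin p) K)) (f : Fin n → MvPolynomial (Fin p) K)
    (h : ∀ s ∈ S, aeval f s ∈ Ideal.span T) (q : MvPolynomial (Fin n) K) :
    presentedMap S T f h (Ideal.Quotient.mk _ q) = Ideal.Quotient.mk _ (aeval f q) :=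
  rfl

theorem Converts.aeval_mem {S : Set (MvPolynomial (Fin n) K)} {T : Set (MvPolynomial (Fin p) K)}
    {f : Fin n → MvPolynomial (Fin p) K} {g : Fin p → MvPolynomial (Fin n) K}
    (h : Converts S T f g) : ∀ s ∈ S, aeval f s ∈ Ideal.span T := fun s hs =>
  mem_span_of_satisfies fun B _ _ y hy => by
    have := (h B y hy).1 s hs
    rwa [← comp_aeval_apply] at this

/-- The undoing identity, evaluated at the generic solution of `T`, says that the composite fixes
every variable. -/
theorem Converts.presentedMap_comp {S : Set (MvPolynomial (Fin n) K)}
    {T : Set (MvPolynomial (Fin p) K)}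
    {f : Fin n → MvPolynomial (Fin p) K} {g : Fin p → MvPolynomial (Fin n) K}
    (h : Converts S T f g) (h' : Converts T S g f) :
    (presentedMap S T f h.aeval_mem).comp (presentedMap T S g h'.aeval_mem) = AlgHom.id K _ := by
  apply Ideal.Quotient.algHom_ext
  ext i
  have := (h _ _ (satisfies_mk_X T)).2 i
  simp only [aeval_mk_X] at this
  rw [← comp_aeval_apply] at this
  change presentedMap S T f h.aeval_mem
    (presentedMap T S g h'.aeval_mem (Ideal.Quotient.mk _ (X i))) = _
  rw [presentedMap_mk, presentedMap_mk, aeval_X]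
  exact this

theorem nonempty_algEquiv_of_converts {S : Set (MvPolynomial (Fin n) K)}
    {m : MvPolynomial (Fin n) K} {T : Set (MvPolynomial (Fin p) K)}
    {f : Fin n → MvPolynomial (Fin p) K} {g : Fin p → MvPolynomial (Fin n) K}
    (h : Converts (insert m S) T f g) (h' : Converts T (insert m S) g f) :
    Nonempty (((MvPolynomial (Fin n) K ⧸ Ideal.span S) ⧸
      Ideal.span {Ideal.Quotient.mk (Ideal.span S) m}) ≃ₐ[K]
        MvPolynomial (Fin p) K ⧸ Ideal.span T) := by
  have h1 : Ideal.span {Ideal.Quotient.mk (Ideal.span S) m} =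
      (Ideal.span {m}).map (Ideal.Quotient.mkₐ K (Ideal.span S)) := by
    rw [Ideal.map_span, Set.image_singleton]; rfl
  have h2 : Ideal.span S ⊔ Ideal.span {m} = Ideal.span (insert m S) := by
    rw [Ideal.span_insert, sup_comm]
  -- Dividing by `S` and then by `m` is dividing by `S` with `m` adjoined; the substitutions give
  -- the last isomorphism.
  exact ⟨(Ideal.quotientEquivAlgOfEq K h1).trans <|
    (DoubleQuot.quotQuotEquivQuotSupₐ K _ _).trans <|
    (Ideal.quotientEquivAlgOfEq K h2).trans <|
    AlgEquiv.ofAlgHom _ _ (h.presentedMap_comp h') (h'.presentedMap_comp h)⟩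

/-! ### Coefficient functionals, nonmembership and dimension -/

/-- The coefficient at the monomial with exponents `e`. -/
noncomputable def coeffAt (e : Fin n → ℕ) : MvPolynomial (Fin n) K →ₗ[K] K :=
  lcoeff K (Finsupp.equivFunOnFinite.symm e)

/-- Peeling off one variable at a time lets `simp` evaluate a coefficient of `a * s` for an unknown
polynomial `a`; the `update_vecCons` lemmas then normalise the exponent vectors. -/
theorem coeffAt_mul_X (e : Fin n → ℕ) (q : MvPolynomial (Fin n) K) (i : Fin n) :
    coeffAt e (q * X i) = if e i = 0 then 0 else coeffAt (Function.update e i (e i - 1)) q := by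
  classical
  simp only [coeffAt, lcoeff_apply, coeff_mul_X']
  by_cases h : e i = 0
  · simp [h]
  · simp only [Finsupp.mem_support_iff, Finsupp.equivFunOnFinite_symm_apply_apply, ne_eq, h,
      not_false_eq_true, if_true, if_false]
    congr 1
    ext j
    by_cases hj : j = i
    · subst hj; simp
    · simp [hj]

theorem coeffAt_one (e : Fin n → ℕ) :
    coeffAt e (1 : MvPolynomial (Fin n) K) = if e = 0 then 1 else 0 := by
  classical
  simp only [coeffAt, lcoeff_apply, coeff_one]
  congr 1
  exact propext (eq_comm.trans (Equiv.symm_apply_eq _))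

theorem coeffAt_X (e : Fin n → ℕ) (i : Fin n) :
    coeffAt e (X i : MvPolynomial (Fin n) K) =
      if e i = 0 then 0 else coeffAt (Function.update e i (e i - 1)) 1 := by
  rw [← coeffAt_mul_X, one_mul]

theorem update_vecCons_zero {α : Type*} (a x : α) (v : Fin n → α) :
    Function.update (Matrix.vecCons a v) 0 x = Matrix.vecCons x v :=
  Fin.update_cons_zero _ _ _

theorem update_vecCons_one {α : Type*} (a b x : α) (v : Fin n → α) :
    Function.update (Matrix.vecCons a (Matrix.vecCons b v)) 1 x =
      Matrix.vecCons a (Matrix.vecCons x v) := by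
  ext i
  refine Fin.cases ?_ (fun i => Fin.cases ?_ (fun i => ?_) i) i <;> rfl

theorem update_vecCons_two {α : Type*} (a b c x : α) (v : Fin n → α) :
    Function.update (Matrix.vecCons a (Matrix.vecCons b (Matrix.vecCons c v))) 2 x =
      Matrix.vecCons a (Matrix.vecCons b (Matrix.vecCons x v)) := by
  ext i
  refine Fin.cases ?_ (fun i => Fin.cases ?_ (fun i => Fin.cases ?_ (fun i => ?_) i) i) i <;> rfl

theorem update_vecCons_three {α : Type*} (a b c d x : α) (v : Fin n → α) :
    Function.update
        (Matrix.vecCons a (Matrix.vecCons b (Matrix.vecCons c (Matrix.vecCons d v)))) 3 x =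
      Matrix.vecCons a (Matrix.vecCons b (Matrix.vecCons c (Matrix.vecCons x v))) := by
  ext i
  refine Fin.cases ?_ (fun i => Fin.cases ?_ (fun i => Fin.cases ?_
    (fun i => Fin.cases ?_ (fun i => ?_) i) i) i) i <;> rfl

theorem update_vecCons_four {α : Type*} (a b c d e x : α) (v : Fin n → α) :
    Function.update (Matrix.vecCons a
        (Matrix.vecCons b (Matrix.vecCons c (Matrix.vecCons d (Matrix.vecCons e v))))) 4 x =
      Matrix.vecCons a
        (Matrix.vecCons b (Matrix.vecCons c (Matrix.vecCons d (Matrix.vecCons x v)))) := by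
  ext i
  refine Fin.cases ?_ (fun i => Fin.cases ?_ (fun i => Fin.cases ?_
    (fun i => Fin.cases ?_ (fun i => Fin.cases ?_ (fun i => ?_) i) i) i) i) i <;> rfl

/-- Vanishing on the generators alone would not suffice, as `c` is only `K`-linear; hence the
hypothesis on all multiples. -/
theorem eq_zero_of_mem_span {S : Set (MvPolynomial (Fin n) K)}
    (c : MvPolynomial (Fin n) K →ₗ[K] K)
    (h : ∀ s ∈ S, ∀ a, c (a * s) = 0) {q : MvPolynomial (Fin n) K} (hq : q ∈ Ideal.span S) :
    c q = 0 := by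
  suffices ∀ a, c (a * q) = 0 by simpa using this 1
  induction hq using Submodule.span_induction with
  | mem x hx => exact h x hx
  | zero => simp
  | add x y _ _ hx hy => intro a; rw [mul_add, map_add, hx, hy, add_zero]
  | smul b x _ hx => intro a; rw [smul_eq_mul, ← mul_assoc]; exact hx _

/-- Here `e` is a candidate basis, `c` its dual family, and `next` the multiplication table by
variables, with `none` for a zero product. The span of `e` contains 1 and is stable under the
variables, hence is everything; the functionals `c` descend to the quotient and give independence.
-/
theorem finrank_quotient_span {k : ℕ} {S : Set (MvPolynomial (Fin n) K)}
    (e : Fin k → MvPolynomial (Fin n) K) (c : Fin k → MvPolynomial (Fin n) K →ₗ[K] K)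
    (next : Fin n → Fin k → Option (Fin k))
    (hc : ∀ j, ∀ s ∈ S, ∀ a, c j (a * s) = 0)
    (hce : ∀ i j, c j (e i) = if i = j then 1 else 0)
    (hone : ∃ j, e j = 1)
    (hnext : ∀ (B : Type u) [CommRing B] [Algebra K B] (y : Fin n → B), Satisfies S y →
      ∀ i j, y i * aeval y (e j) = (next i j).elim 0 fun l => aeval y (e l)) :
    Module.Finite K (MvPolynomial (Fin n) K ⧸ Ideal.span S) ∧
      Module.finrank K (MvPolynomial (Fin n) K ⧸ Ideal.span S) = k := by
  set I := Ideal.span S with hI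
  have hspan : Submodule.span K (Set.range fun j => Ideal.Quotient.mk I (e j)) = ⊤ := by
    rw [eq_top_iff]
    rintro q -
    obtain ⟨q, rfl⟩ := Ideal.Quotient.mk_surjective q
    set W := Submodule.span K (Set.range fun j => Ideal.Quotient.mk I (e j)) with hW
    have hmul (i : Fin n) (w) (hw : w ∈ W) : w * Ideal.Quotient.mk I (X i) ∈ W := by
      induction hw using Submodule.span_induction with
      | mem x hx =>
        obtain ⟨j, rfl⟩ := hx
        have h := hnext _ _ (satisfies_mk_X S) i j
        rw [aeval_mk_X] at h
        rw [mul_comm]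
        refine (congrArg (· ∈ W) h).mpr ?_
        cases next i j with
        | none => exact W.zero_mem
        | some l => exact Submodule.subset_span ⟨l, rfl⟩
      | zero => simp
      | add x y _ _ hx hy => rw [add_mul]; exact W.add_mem hx hy
      | smul a x _ hx => rw [smul_mul_assoc]; exact W.smul_mem _ hx
    induction q using MvPolynomial.induction_on with
    | C a =>
      obtain ⟨j, hj⟩ := hone
      have : Ideal.Quotient.mk I (C a) = a • Ideal.Quotient.mk I (e j) := by
        rw [hj]
        change _ = a • Ideal.Quotient.mkₐ K I 1
        rw [← map_smul, smul_eq_C_mul, mul_one]; rfl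
      rw [this]
      exact W.smul_mem _ (Submodule.subset_span ⟨j, rfl⟩)
    | add p q hp hq => rw [map_add]; exact W.add_mem hp hq
    | mul_X p i hp => rw [map_mul]; exact hmul i _ hp
  have hli : LinearIndependent K fun j => Ideal.Quotient.mk I (e j) := by
    rw [Fintype.linearIndependent_iff]
    intro g hg j
    have h0 : Ideal.Quotient.mk I (∑ i, g i • e i) = 0 := by
      rw [← hg, map_sum]; rfl
    have h1 := eq_zero_of_mem_span (c j) (hc j) (Ideal.Quotient.eq_zero_iff_mem.1 h0)
    simpa [hce] using h1
  let b := Module.Basis.mk hli hspan.ge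
  exact ⟨.of_basis b, by rw [Module.finrank_eq_card_basis b, Fintype.card_fin]⟩

/-- The class of `m` modulo `I` is nonzero, and dividing by it gives the quotient by `J`. -/
def Reduces (I : Ideal (MvPolynomial (Fin n) K)) (m : MvPolynomial (Fin n) K)
    (J : Ideal (MvPolynomial (Fin p) K)) : Prop :=
  m ∉ I ∧ Nonempty (((MvPolynomial (Fin n) K ⧸ I) ⧸
    Ideal.span {Ideal.Quotient.mk I m}) ≃ₐ[K] MvPolynomial (Fin p) K ⧸ J)

set_option linter.unusedSimpArgs false

/-- A criterion for `Reduces` whose hypotheses, for concrete presentations, are checked by the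
default tactics. -/
theorem Reduces.of_converts {I : Ideal (MvPolynomial (Fin n) K)} {m : MvPolynomial (Fin n) K}
    {J : Ideal (MvPolynomial (Fin p) K)} {S : Set (MvPolynomial (Fin n) K)}
    {T : Set (MvPolynomial (Fin p) K)} (hI : I = Ideal.span S) (hJ : J = Ideal.span T)
    (f : Fin n → MvPolynomial (Fin p) K) (g : Fin p → MvPolynomial (Fin n) K)
    (c : MvPolynomial (Fin n) K →ₗ[K] K)
    (h : Converts (insert m S) T f g := by
      intro B _ _ y h
      simp only [Satisfies, Set.mem_insert_iff, Set.mem_singleton_iff, forall_eq_or_imp, forall_eq,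
        map_add, map_sub, map_mul, map_pow, map_neg, map_zero, aeval_X, Fin.forall_fin_succ,
        Fin.forall_fin_zero, IsEmpty.forall_iff, Matrix.cons_val, Fin.succ_zero_eq_one,
        Fin.succ_one_eq_two, Matrix.cons_val_succ, Set.mem_empty_iff_false, Fin.isValue,
        Matrix.cons_val_zero] at h ⊢
      grind)
    (h' : Converts T (insert m S) g f := by
      intro B _ _ y h
      simp only [Satisfies, Set.mem_insert_iff, Set.mem_singleton_iff, forall_eq_or_imp, forall_eq,
        map_add, map_sub, map_mul, map_pow, map_neg, map_zero, aeval_X, Fin.forall_fin_succ,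
        Fin.forall_fin_zero, IsEmpty.forall_iff, Matrix.cons_val, Fin.succ_zero_eq_one,
        Fin.succ_one_eq_two, Matrix.cons_val_succ, Set.mem_empty_iff_false, Fin.isValue,
        Matrix.cons_val_zero] at h ⊢
      grind)
    (hc : ∀ s ∈ S, ∀ a, c (a * s) = 0 := by
      simp [mul_add, mul_sub, pow_succ, ← mul_assoc, coeffAt_mul_X, update_vecCons_zero,
        update_vecCons_one, update_vecCons_two, update_vecCons_three, update_vecCons_four])
    (hm : c m ≠ 0 := by
      simp [pow_succ, ← mul_assoc, coeffAt_mul_X, coeffAt_one, coeffAt_X, update_vecCons_zero,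
        update_vecCons_one, update_vecCons_two, update_vecCons_three, update_vecCons_four]) :
    Reduces I m J := by
  subst hI hJ
  exact ⟨fun hmS => hm (eq_zero_of_mem_span c hc hmS), nonempty_algEquiv_of_converts h h'⟩

end Presentation

/-! ### Powers of ideals with few generators -/

section Powers

variable {R : Type*} [CommRing R]

theorem span_pair_sq (a b : R) :
    Ideal.span {a, b} ^ 2 = Ideal.span {a ^ 2, a * b, b ^ 2} := by
  rw [pow_two, Ideal.span_mul_span']
  congr 1
  ext x
  simp only [Set.mem_mul, Set.mem_insert_iff, Set.mem_singleton_iff, exists_eq_or_imp,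
    exists_eq_left]
  grind

theorem span_three_sq (a b c : R) :
    Ideal.span {a, b, c} ^ 2 = Ideal.span {a ^ 2, a * b, a * c, b ^ 2, b * c, c ^ 2} := by
  rw [pow_two, Ideal.span_mul_span']
  congr 1
  ext x
  simp only [Set.mem_mul, Set.mem_insert_iff, Set.mem_singleton_iff, exists_eq_or_imp,
    exists_eq_left]
  grind

theorem span_four_sq (a b c d : R) :
    Ideal.span {a, b, c, d} ^ 2 = Ideal.span
      {a ^ 2, a * b, a * c, a * d, b ^ 2, b * c, b * d, c ^ 2, c * d, d ^ 2} := by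
  rw [pow_two, Ideal.span_mul_span']
  congr 1
  ext x
  simp only [Set.mem_mul, Set.mem_insert_iff, Set.mem_singleton_iff, exists_eq_or_imp,
    exists_eq_left]
  grind

theorem span_five_sq (a b c d e : R) :
    Ideal.span {a, b, c, d, e} ^ 2 = Ideal.span
      {a ^ 2, a * b, a * c, a * d, a * e, b ^ 2, b * c, b * d, b * e, c ^ 2, c * d, c * e, d ^ 2,
        d * e, e ^ 2} := by
  rw [pow_two, Ideal.span_mul_span']
  congr 1
  ext x
  simp only [Set.mem_mul, Set.mem_insert_iff, Set.mem_singleton_iff, exists_eq_or_imp,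
    exists_eq_left]
  grind (splits := 30)

theorem span_pair_cube (a b : R) :
    Ideal.span {a, b} ^ 3 = Ideal.span {a ^ 3, a ^ 2 * b, a * b ^ 2, b ^ 3} := by
  rw [pow_succ, span_pair_sq, Ideal.span_mul_span']
  congr 1
  ext x
  simp only [Set.mem_mul, Set.mem_insert_iff, Set.mem_singleton_iff, exists_eq_or_imp,
    exists_eq_left]
  grind

end Powers

/-! ### The algebras on which the second player wins -/

section Targets

open MvPolynomial

universe u

variable {K : Type u} [Field K] {n : ℕ}

/-- NONE -/
theorem losing_bot_quotient {R : Type*} [CommRing R] {I : Ideal R} (h : Losing I) :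
    Losing (⊥ : Ideal (R ⧸ I)) := by
  refine .of_comap (Ideal.Quotient.mk I) Ideal.Quotient.mk_surjective ?_
  rwa [← RingHom.ker_eq_comap_bot, Ideal.mk_ker]

theorem span_le_span_of_satisfies {S T : Set (MvPolynomial (Fin n) K)}
    (h : ∀ (B : Type u) [CommRing B] [Algebra K B] (y : Fin n → B),
      Satisfies S y → Satisfies T y) : Ideal.span T ≤ Ideal.span S :=
  Ideal.span_le.2 fun t ht => mem_span_of_satisfies fun B _ _ y hy => h B y hy t ht

variable (K)

set_option linter.unusedSimpArgs false

theorem losing_bot_zero : Losing (⊥ : Ideal (MvPolynomial (Fin 0) K)) := by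
  have h := finrank_quotient_span (K := K) (n := 0) (S := ∅) ![1] ![coeffAt ![]]
    (fun _ _ => none) (by simp) (by simp [coeffAt_one]) ⟨0, rfl⟩ (fun B _ _ y h i => i.elim0)
  rw [Ideal.span_empty] at h
  have := h.1
  -- With no variables the maximal ideal is zero, so `M` and `I` are both `⊥`, of codimension 1.
  exact losing_of_odd_finrank h.2 (Ideal.pow_le_self two_ne_zero) le_rfl (by rw [h.2]; decide)

theorem finrank_quotient_span_pair :
    Module.finrank K (MvPolynomial (Fin 2) K ⧸ Ideal.span {X (R := K) (0 : Fin 2), X 1}) = 1 := by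
  refine (finrank_quotient_span ![1] ![coeffAt ![0, 0]] (fun _ _ => none) ?_ ?_ ⟨0, rfl⟩ ?_).2
  · simp [coeffAt_mul_X]
  · simp [coeffAt_one]
  · intro B _ _ y h
    simp [Satisfies, Fin.forall_fin_succ] at h ⊢
    exact h

theorem finrank_quotient_span_pair_sq :
    Module.Finite K
        (MvPolynomial (Fin 2) K ⧸ Ideal.span {X (R := K) (0 : Fin 2), X 1} ^ 2) ∧
      Module.finrank K
        (MvPolynomial (Fin 2) K ⧸ Ideal.span {X (R := K) (0 : Fin 2), X 1} ^ 2) = 3 := by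
  rw [span_pair_sq]
  refine finrank_quotient_span ![1, X 0, X 1] ![coeffAt ![0, 0], coeffAt ![1, 0], coeffAt ![0, 1]]
    ![![some 1, none, none], ![some 2, none, none]] ?_ ?_ ⟨0, rfl⟩ ?_
  · simp [Fin.forall_fin_succ, pow_succ, ← mul_assoc, coeffAt_mul_X, update_vecCons_zero,
      update_vecCons_one]
  · simp [Fin.forall_fin_succ, coeffAt_X, coeffAt_one, update_vecCons_zero, update_vecCons_one]
  · intro B _ _ y h
    simp [Satisfies, Fin.forall_fin_succ] at h ⊢
    grind

theorem losing_span_pair_sq :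
    Losing (Ideal.span {X (R := K) (0 : Fin 2), X 1} ^ 2) := by
  have h := finrank_quotient_span_pair_sq K
  have := h.1
  exact losing_of_odd_finrank (finrank_quotient_span_pair K) le_rfl
    (Ideal.pow_le_self two_ne_zero) (by rw [h.2]; decide)

theorem losing_span_four_sq :
    Losing (Ideal.span {X (R := K) (0 : Fin 4), X 1, X 2, X 3} ^ 2) := by
  have h1 : Module.finrank K
      (MvPolynomial (Fin 4) K ⧸ Ideal.span {X (R := K) (0 : Fin 4), X 1, X 2, X 3}) = 1 := by
    refine (finrank_quotient_span ![1] ![coeffAt ![0, 0, 0, 0]] (fun _ _ => none)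
      ?_ ?_ ⟨0, rfl⟩ ?_).2
    · simp [coeffAt_mul_X]
    · simp [coeffAt_one]
    · intro B _ _ y h
      simp [Satisfies, Fin.forall_fin_succ] at h ⊢
      exact h
  have h : Module.Finite K (MvPolynomial (Fin 4) K ⧸
        Ideal.span {X (R := K) (0 : Fin 4), X 1, X 2, X 3} ^ 2) ∧
      Module.finrank K (MvPolynomial (Fin 4) K ⧸
        Ideal.span {X (R := K) (0 : Fin 4), X 1, X 2, X 3} ^ 2) = 5 := by
    rw [span_four_sq]
    refine finrank_quotient_span ![1, X 0, X 1, X 2, X 3]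
      ![coeffAt ![0, 0, 0, 0], coeffAt ![1, 0, 0, 0], coeffAt ![0, 1, 0, 0],
        coeffAt ![0, 0, 1, 0], coeffAt ![0, 0, 0, 1]]
      ![![some 1, none, none, none, none], ![some 2, none, none, none, none],
        ![some 3, none, none, none, none], ![some 4, none, none, none, none]] ?_ ?_ ⟨0, rfl⟩ ?_
    · simp [Fin.forall_fin_succ, pow_succ, ← mul_assoc, coeffAt_mul_X, update_vecCons_zero,
        update_vecCons_one, update_vecCons_two, update_vecCons_three]
    · simp [Fin.forall_fin_succ, coeffAt_X, coeffAt_one, update_vecCons_zero, update_vecCons_one,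
        update_vecCons_two, update_vecCons_three]
    · intro B _ _ y h
      simp [Satisfies, Fin.forall_fin_succ] at h ⊢
      grind
  have := h.1
  exact losing_of_odd_finrank h1 le_rfl (Ideal.pow_le_self two_ne_zero) (by rw [h.2]; decide)

theorem losing_span_R12 :
    Losing (Ideal.span {X 0 * X 1, X 0 ^ 3, X 1 ^ 3} : Ideal (MvPolynomial (Fin 2) K)) := by
  have h : Module.Finite K (MvPolynomial (Fin 2) K ⧸
        (Ideal.span {X 0 * X 1, X 0 ^ 3, X 1 ^ 3} : Ideal (MvPolynomial (Fin 2) K))) ∧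
      Module.finrank K (MvPolynomial (Fin 2) K ⧸
        (Ideal.span {X 0 * X 1, X 0 ^ 3, X 1 ^ 3} : Ideal (MvPolynomial (Fin 2) K))) = 5 := by
    -- Monomial basis `1, x, y, x², y²`; the only nonzero products of positive degree are `x * x`
    -- and `y * y`.
    refine finrank_quotient_span ![1, X 0, X 1, X 0 ^ 2, X 1 ^ 2]
      ![coeffAt ![0, 0], coeffAt ![1, 0], coeffAt ![0, 1], coeffAt ![2, 0], coeffAt ![0, 2]]
      ![![some 1, some 3, none, none, none], ![some 2, none, some 4, none, none]]
      ?_ ?_ ⟨0, rfl⟩ ?_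
    · simp [Fin.forall_fin_succ, pow_succ, ← mul_assoc, coeffAt_mul_X, update_vecCons_zero,
        update_vecCons_one]
    · simp [Fin.forall_fin_succ, pow_succ, coeffAt_mul_X, coeffAt_X, coeffAt_one,
        update_vecCons_zero, update_vecCons_one]
    · intro B _ _ y h
      simp [Satisfies, Fin.forall_fin_succ] at h ⊢
      grind
  have := h.1
  refine losing_of_finrank_eq_five (finrank_quotient_span_pair K)
    (finrank_quotient_span_pair_sq K).2 ?_ ?_ h.2
  · rw [span_pair_cube]
    refine span_le_span_of_satisfies fun B _ _ y h => ?_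
    simp [Satisfies] at h ⊢
    grind
  · rw [span_pair_sq]
    refine span_le_span_of_satisfies fun B _ _ y h => ?_
    simp [Satisfies] at h ⊢
    grind

theorem losing_span_R13 :
    Losing (Ideal.span {X 0 ^ 2, X 0 * X 1 ^ 2, X 1 ^ 3} : Ideal (MvPolynomial (Fin 2) K)) := by
  have h : Module.Finite K (MvPolynomial (Fin 2) K ⧸
        (Ideal.span {X 0 ^ 2, X 0 * X 1 ^ 2, X 1 ^ 3} : Ideal (MvPolynomial (Fin 2) K))) ∧
      Module.finrank K (MvPolynomial (Fin 2) K ⧸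
        (Ideal.span {X 0 ^ 2, X 0 * X 1 ^ 2, X 1 ^ 3} : Ideal (MvPolynomial (Fin 2) K))) = 5 := by
    -- Monomial basis `1, x, y, xy, y²`, giving Hilbert function 1, 2, 2 again.
    refine finrank_quotient_span ![1, X 0, X 1, X 0 * X 1, X 1 ^ 2]
      ![coeffAt ![0, 0], coeffAt ![1, 0], coeffAt ![0, 1], coeffAt ![1, 1], coeffAt ![0, 2]]
      ![![some 1, none, some 3, none, none], ![some 2, some 3, some 4, none, none]]
      ?_ ?_ ⟨0, rfl⟩ ?_
    · simp [Fin.forall_fin_succ, pow_succ, ← mul_assoc, coeffAt_mul_X, update_vecCons_zero,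
        update_vecCons_one]
    · simp [Fin.forall_fin_succ, pow_succ, coeffAt_mul_X, coeffAt_X, coeffAt_one,
        update_vecCons_zero, update_vecCons_one]
    · intro B _ _ y h
      simp [Satisfies, Fin.forall_fin_succ] at h ⊢
      grind
  have := h.1
  refine losing_of_finrank_eq_five (finrank_quotient_span_pair K)
    (finrank_quotient_span_pair_sq K).2 ?_ ?_ h.2
  · rw [span_pair_cube]
    refine span_le_span_of_satisfies fun B _ _ y h => ?_
    simp [Satisfies] at h ⊢
    grind
  · rw [span_pair_sq]
    refine span_le_span_of_satisfies fun B _ _ y h => ?_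
    simp [Satisfies] at h ⊢
    grind

end Targets

/-! ### The rows of the table -/

section Rows

open MvPolynomial

universe u

variable (K : Type u) [Field K]

theorem reduces_R2 : Reduces (K := K) (n := 1) (p := 0)
    (Ideal.span {X 0 ^ 2}) (X 0) ⊥ :=
  .of_converts rfl Ideal.span_empty.symm (fun _ => 0) Fin.elim0
    (coeffAt ![1])

theorem reduces_R3 : Reduces (K := K) (n := 1) (p := 0)
    (Ideal.span {X 0 ^ 3}) (X 0) ⊥ :=
  .of_converts rfl Ideal.span_empty.symm (fun _ => 0) Fin.elim0
    (coeffAt ![1])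

theorem reduces_R5 : Reduces (K := K) (n := 1) (p := 0)
    (Ideal.span {X 0 ^ 4}) (X 0) ⊥ :=
  .of_converts rfl Ideal.span_empty.symm (fun _ => 0) Fin.elim0
    (coeffAt ![1])

theorem reduces_R6 : Reduces (K := K) (n := 2) (p := 2)
    (Ideal.span {X 0 ^ 2, X 0 * X 1, X 1 ^ 3}) (X 1 ^ 2) (Ideal.span {X 0, X 1} ^ 2) :=
  .of_converts rfl (span_pair_sq _ _) X X
    (coeffAt ![0, 2])

theorem reduces_R7 : Reduces (K := K) (n := 2) (p := 2)
    (Ideal.span {X 0 ^ 2, X 1 ^ 2}) (X 0 * X 1) (Ideal.span {X 0, X 1} ^ 2) :=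
  .of_converts rfl (span_pair_sq _ _) X X
    (coeffAt ![1, 1])

theorem reduces_R7s : Reduces (K := K) (n := 2) (p := 2)
    (Ideal.span {X 0 ^ 2 + X 1 ^ 2, X 0 * X 1}) (X 0 ^ 2) (Ideal.span {X 0, X 1} ^ 2) :=
  .of_converts rfl (span_pair_sq _ _) X X
    -- The relation identifies `x ^ 2` with `-y ^ 2`, so only the difference of the two coefficients
    -- is well defined on the quotient. The other rows with a binomial relation meeting the move's
    -- monomial are handled likewise.
    (coeffAt ![2, 0] - coeffAt ![0, 2])

theorem reduces_R8 : Reduces (K := K) (n := 3) (p := 2)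
    (Ideal.span {X 0, X 1, X 2} ^ 2) (X 2) (Ideal.span {X 0, X 1} ^ 2) :=
  .of_converts (span_three_sq _ _ _) (span_pair_sq _ _) ![X 0, X 1, 0] ![X 0, X 1]
    (coeffAt ![0, 0, 1])

theorem reduces_R9 : Reduces (K := K) (n := 1) (p := 0)
    (Ideal.span {X 0 ^ 5}) (X 0) ⊥ :=
  .of_converts rfl Ideal.span_empty.symm (fun _ => 0) Fin.elim0
    (coeffAt ![1])

theorem reduces_R10 : Reduces (K := K) (n := 2) (p := 2)
    (Ideal.span {X 0 ^ 2, X 0 * X 1, X 1 ^ 4}) (X 1 ^ 2) (Ideal.span {X 0, X 1} ^ 2) :=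
  .of_converts rfl (span_pair_sq _ _) X X
    (coeffAt ![0, 2])

theorem reduces_R11 : Reduces (K := K) (n := 2) (p := 2)
    (Ideal.span {X 0 ^ 2 + X 1 ^ 3, X 0 * X 1}) (X 1 ^ 2) (Ideal.span {X 0, X 1} ^ 2) :=
  .of_converts rfl (span_pair_sq _ _) X X
    (coeffAt ![0, 2])

theorem reduces_R14 : Reduces (K := K) (n := 3) (p := 2)
    (Ideal.span {X 0 ^ 2, X 1 ^ 2, X 0 * X 1, X 0 * X 2, X 1 * X 2,
      X 2 ^ 3}) (X 2) (Ideal.span {X 0, X 1} ^ 2) :=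
  .of_converts rfl (span_pair_sq _ _) ![X 0, X 1, 0] ![X 0, X 1]
    (coeffAt ![0, 0, 1])

theorem reduces_R15 : Reduces (K := K) (n := 3) (p := 2)
    (Ideal.span {X 0 ^ 2, X 1 ^ 2, X 2 ^ 2, X 0 * X 1, X 0 * X 2}) (X 2) (Ideal.span {X 0,
      X 1} ^ 2) :=
  .of_converts rfl (span_pair_sq _ _) ![X 0, X 1, 0] ![X 0, X 1]
    (coeffAt ![0, 0, 1])

theorem reduces_R15s : Reduces (K := K) (n := 3) (p := 2)
    (Ideal.span {X 0 ^ 2, X 0 * X 1, X 0 * X 2, X 1 * X 2,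
      X 1 ^ 2 + X 2 ^ 2}) (X 2) (Ideal.span {X 0, X 1} ^ 2) :=
  .of_converts rfl (span_pair_sq _ _) ![X 0, X 1, 0] ![X 0, X 1]
    (coeffAt ![0, 0, 1])

theorem reduces_R16 : Reduces (K := K) (n := 3) (p := 2)
    (Ideal.span {X 0 * X 1, X 0 * X 2, X 1 * X 2, X 0 ^ 2 + X 1 ^ 2,
      X 0 ^ 2 + X 2 ^ 2}) (X 0) (Ideal.span {X 0, X 1} ^ 2) :=
  .of_converts rfl (span_pair_sq _ _) ![0, X 0, X 1] ![X 1, X 2]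
    (coeffAt ![1, 0, 0])

theorem reduces_R18 : Reduces (K := K) (n := 1) (p := 0)
    (Ideal.span {X 0 ^ 6}) (X 0) ⊥ :=
  .of_converts rfl Ideal.span_empty.symm (fun _ => 0) Fin.elim0
    (coeffAt ![1])

theorem reduces_R19 : Reduces (K := K) (n := 2) (p := 2)
    (Ideal.span {X 0 ^ 2, X 0 * X 1, X 1 ^ 5}) (X 1 ^ 2) (Ideal.span {X 0, X 1} ^ 2) :=
  .of_converts rfl (span_pair_sq _ _) X X
    (coeffAt ![0, 2])

theorem reduces_R20 : Reduces (K := K) (n := 2) (p := 2)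
    (Ideal.span {X 0 ^ 2 + X 1 ^ 4, X 0 * X 1}) (X 1 ^ 2) (Ideal.span {X 0, X 1} ^ 2) :=
  .of_converts rfl (span_pair_sq _ _) X X
    (coeffAt ![0, 2])

theorem reduces_R21 : Reduces (K := K) (n := 2) (p := 2)
    (Ideal.span {X 0 * X 1, X 0 ^ 3, X 1 ^ 4}) (X 1 ^ 3) (Ideal.span {X 0 * X 1, X 0 ^ 3,
      X 1 ^ 3}) :=
  .of_converts rfl rfl X X
    (coeffAt ![0, 3])

theorem reduces_R22 : Reduces (K := K) (n := 2) (p := 2)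
    (Ideal.span {X 0 * X 1, X 0 ^ 3 + X 1 ^ 3}) (X 0 ^ 3) (Ideal.span {X 0 * X 1, X 0 ^ 3,
      X 1 ^ 3}) :=
  .of_converts rfl rfl X X
    (coeffAt ![3, 0] - coeffAt ![0, 3])

theorem reduces_R23 : Reduces (K := K) (n := 2) (p := 2)
    (Ideal.span {X 0 ^ 2, X 0 * X 1 ^ 2, X 1 ^ 4}) (X 1 ^ 3) (Ideal.span {X 0 ^ 2, X 0 * X 1 ^ 2,
      X 1 ^ 3}) :=
  .of_converts rfl rfl X X
    (coeffAt ![0, 3])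

theorem reduces_R24 : Reduces (K := K) (n := 2) (p := 2)
    (Ideal.span {X 0 ^ 2 + X 1 ^ 3, X 0 * X 1 ^ 2, X 1 ^ 4}) (X 1 ^ 3) (Ideal.span {X 0 ^ 2,
      X 0 * X 1 ^ 2, X 1 ^ 3}) :=
  .of_converts rfl rfl X X
    (coeffAt ![0, 3] - coeffAt ![2, 0])

theorem reduces_R25 : Reduces (K := K) (n := 2) (p := 2)
    (Ideal.span {X 0 ^ 2, X 1 ^ 3}) (X 0 * X 1 ^ 2) (Ideal.span {X 0 ^ 2, X 0 * X 1 ^ 2,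
      X 1 ^ 3}) :=
  .of_converts rfl rfl X X
    (coeffAt ![1, 2])

theorem reduces_R25s : Reduces (K := K) (n := 2) (p := 2)
    (Ideal.span {X 0 ^ 2 + X 0 * X 1 ^ 2, X 1 ^ 3}) (X 0 ^ 2) (Ideal.span {X 0 ^ 2,
      X 0 * X 1 ^ 2, X 1 ^ 3}) :=
  .of_converts rfl rfl X X
    (coeffAt ![2, 0] - coeffAt ![1, 2])

theorem reduces_R25ss : Reduces (K := K) (n := 2) (p := 2)
    (Ideal.span {X 0 ^ 2, X 0 * X 1 ^ 2 + X 1 ^ 3}) (X 1 ^ 3) (Ideal.span {X 0 ^ 2,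
      X 0 * X 1 ^ 2, X 1 ^ 3}) :=
  .of_converts rfl rfl X X
    (coeffAt ![0, 3] - coeffAt ![1, 2])

theorem reduces_R26 : Reduces (K := K) (n := 2) (p := 2)
    (Ideal.span {X 0, X 1} ^ 3) (X 0 * X 1) (Ideal.span {X 0 * X 1, X 0 ^ 3, X 1 ^ 3}) :=
  .of_converts (span_pair_cube _ _) rfl X X
    (coeffAt ![1, 1])

theorem reduces_R27 : Reduces (K := K) (n := 3) (p := 2)
    (Ideal.span {X 0 ^ 2, X 0 * X 1, X 1 ^ 2, X 0 * X 2, X 1 * X 2,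
      X 2 ^ 4}) (X 2) (Ideal.span {X 0, X 1} ^ 2) :=
  .of_converts rfl (span_pair_sq _ _) ![X 0, X 1, 0] ![X 0, X 1]
    (coeffAt ![0, 0, 1])

theorem reduces_R28 : Reduces (K := K) (n := 3) (p := 2)
    (Ideal.span {X 0 ^ 2, X 0 * X 1, X 1 ^ 2 + X 2 ^ 3, X 0 * X 2, X 1 * X 2,
      X 2 ^ 4}) (X 2) (Ideal.span {X 0, X 1} ^ 2) :=
  .of_converts rfl (span_pair_sq _ _) ![X 0, X 1, 0] ![X 0, X 1]
    (coeffAt ![0, 0, 1])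

theorem reduces_R29 : Reduces (K := K) (n := 3) (p := 2)
    (Ideal.span {X 0 ^ 2, X 0 * X 1 + X 2 ^ 3, X 1 ^ 2, X 0 * X 2, X 1 * X 2,
      X 2 ^ 4}) (X 2) (Ideal.span {X 0, X 1} ^ 2) :=
  .of_converts rfl (span_pair_sq _ _) ![X 0, X 1, 0] ![X 0, X 1]
    (coeffAt ![0, 0, 1])

theorem reduces_R29s : Reduces (K := K) (n := 3) (p := 2)
    (Ideal.span {X 0 ^ 2 + X 2 ^ 3, X 0 * X 1, X 1 ^ 2 + X 2 ^ 3, X 0 * X 2, X 1 * X 2,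
      X 2 ^ 4}) (X 2) (Ideal.span {X 0, X 1} ^ 2) :=
  .of_converts rfl (span_pair_sq _ _) ![X 0, X 1, 0] ![X 0, X 1]
    (coeffAt ![0, 0, 1])

theorem reduces_R30 : Reduces (K := K) (n := 3) (p := 2)
    (Ideal.span {X 0 * X 1, X 1 * X 2, X 2 ^ 2, X 1 ^ 2 - X 0 * X 2,
      X 0 ^ 3}) (X 0) (Ideal.span {X 0, X 1} ^ 2) :=
  .of_converts rfl (span_pair_sq _ _) ![0, X 0, X 1] ![X 1, X 2]
    (coeffAt ![1, 0, 0])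

theorem reduces_R31 : Reduces (K := K) (n := 3) (p := 2)
    (Ideal.span {X 0 * X 1, X 2 ^ 2, X 0 * X 2 - X 1 * X 2,
      X 0 ^ 2 + X 1 ^ 2 - X 0 * X 2}) (X 0) (Ideal.span {X 0, X 1} ^ 2) :=
  .of_converts rfl (span_pair_sq _ _) ![0, X 0, X 1] ![X 1, X 2]
    (coeffAt ![1, 0, 0])

theorem reduces_R31s : Reduces (K := K) (n := 3) (p := 2)
    (Ideal.span {X 0 ^ 2, X 2 ^ 2, X 1 ^ 2 - X 0 * X 2, X 1 * X 2}) (X 0) (Ideal.span {X 0,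
      X 1} ^ 2) :=
  .of_converts rfl (span_pair_sq _ _) ![0, X 0, X 1] ![X 1, X 2]
    (coeffAt ![1, 0, 0])

theorem reduces_R32 : Reduces (K := K) (n := 3) (p := 2)
    (Ideal.span {X 0 ^ 2, X 0 * X 1, X 0 * X 2, X 1 ^ 2, X 1 * X 2 ^ 2,
      X 2 ^ 3}) (X 2) (Ideal.span {X 0, X 1} ^ 2) :=
  .of_converts rfl (span_pair_sq _ _) ![X 0, X 1, 0] ![X 0, X 1]
    (coeffAt ![0, 0, 1])

theorem reduces_R33 : Reduces (K := K) (n := 3) (p := 2)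
    (Ideal.span {X 0 ^ 2, X 0 * X 1, X 0 * X 2, X 1 * X 2, X 1 ^ 3,
      X 2 ^ 3}) (X 0) (Ideal.span {X 0 * X 1, X 0 ^ 3, X 1 ^ 3}) :=
  .of_converts rfl rfl ![0, X 0, X 1] ![X 1, X 2]
    (coeffAt ![1, 0, 0])

theorem reduces_R34 : Reduces (K := K) (n := 3) (p := 2)
    (Ideal.span {X 0 * X 1, X 0 * X 2, X 1 ^ 2, X 2 ^ 2, X 0 ^ 3}) (X 0 + X 1) (Ideal.span {X 0,
      X 1} ^ 2) :=
  -- Killing `x + y` means `y = -x`; then `x * y = 0` forces `x ^ 2 = 0`.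
  .of_converts rfl (span_pair_sq _ _) ![X 0, -X 0, X 1] ![X 0, X 2]
    (coeffAt ![1, 0, 0])

theorem reduces_R34s : Reduces (K := K) (n := 3) (p := 2)
    (Ideal.span {X 0 * X 1, X 0 * X 2, X 1 * X 2, X 1 ^ 2 - X 2 ^ 2,
      X 0 ^ 3}) (X 0 + X 1) (Ideal.span {X 0, X 1} ^ 2) :=
  .of_converts rfl (span_pair_sq _ _) ![X 0, -X 0, X 1] ![X 0, X 2]
    (coeffAt ![1, 0, 0])

theorem reduces_R35 : Reduces (K := K) (n := 3) (p := 2)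
    (Ideal.span {X 0 * X 1, X 0 * X 2, X 1 * X 2,
      X 0 ^ 2 + X 1 ^ 2 - X 2 ^ 2}) (X 0 + X 1) (Ideal.span {X 0, X 1} ^ 2) :=
  .of_converts rfl (span_pair_sq _ _) ![X 0, -X 0, X 1] ![X 0, X 2]
    (coeffAt ![1, 0, 0])

theorem reduces_R36 : Reduces (K := K) (n := 3) (p := 2)
    (Ideal.span {X 0 ^ 2, X 0 * X 1, X 1 * X 2, X 1 ^ 2 - X 2 ^ 2}) (X 2) (Ideal.span {X 0,
      X 1} ^ 2) :=
  .of_converts rfl (span_pair_sq _ _) ![X 0, X 1, 0] ![X 0, X 1]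
    (coeffAt ![0, 0, 1])

theorem reduces_R36s : Reduces (K := K) (n := 3) (p := 2)
    (Ideal.span {X 0 ^ 2, X 0 * X 1, X 1 * X 2,
      X 0 * X 2 + X 1 ^ 2 - X 2 ^ 2}) (X 2) (Ideal.span {X 0, X 1} ^ 2) :=
  .of_converts rfl (span_pair_sq _ _) ![X 0, X 1, 0] ![X 0, X 1]
    (coeffAt ![0, 0, 1])

theorem reduces_R37 : Reduces (K := K) (n := 3) (p := 2)
    (Ideal.span {X 0 ^ 2, X 0 * X 1, X 1 ^ 2, X 2 ^ 2}) (X 2) (Ideal.span {X 0, X 1} ^ 2) :=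
  .of_converts rfl (span_pair_sq _ _) ![X 0, X 1, 0] ![X 0, X 1]
    (coeffAt ![0, 0, 1])

theorem reduces_R37s : Reduces (K := K) (n := 3) (p := 2)
    (Ideal.span {X 0 ^ 2, X 0 * X 1, X 1 ^ 2, X 2 ^ 2 - X 0 * X 2}) (X 2) (Ideal.span {X 0,
      X 1} ^ 2) :=
  .of_converts rfl (span_pair_sq _ _) ![X 0, X 1, 0] ![X 0, X 1]
    (coeffAt ![0, 0, 1])

theorem reduces_R38 : Reduces (K := K) (n := 4) (p := 4)
    (Ideal.span {X 0 ^ 2, X 1 ^ 2, X 2 ^ 2, X 0 * X 1, X 0 * X 2, X 0 * X 3, X 1 * X 2,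
      X 1 * X 3, X 2 * X 3, X 3 ^ 3}) (X 3 ^ 2) (Ideal.span {X 0, X 1, X 2, X 3} ^ 2) :=
  .of_converts rfl (span_four_sq _ _ _ _) X X
    (coeffAt ![0, 0, 0, 2])

theorem reduces_R39 : Reduces (K := K) (n := 4) (p := 4)
    (Ideal.span {X 0 ^ 2, X 1 ^ 2, X 2 ^ 2, X 3 ^ 2, X 0 * X 1, X 0 * X 2, X 0 * X 3, X 1 * X 2,
      X 1 * X 3}) (X 2 * X 3) (Ideal.span {X 0, X 1, X 2, X 3} ^ 2) :=
  .of_converts rfl (span_four_sq _ _ _ _) X X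
    (coeffAt ![0, 0, 1, 1])

theorem reduces_R39s : Reduces (K := K) (n := 4) (p := 4)
    (Ideal.span {X 0 ^ 2, X 1 ^ 2, X 2 ^ 2 + X 3 ^ 2, X 0 * X 1, X 0 * X 2, X 0 * X 3, X 1 * X 2,
      X 1 * X 3, X 2 * X 3}) (X 2 ^ 2) (Ideal.span {X 0, X 1, X 2, X 3} ^ 2) :=
  .of_converts rfl (span_four_sq _ _ _ _) X X
    (coeffAt ![0, 0, 2, 0] - coeffAt ![0, 0, 0, 2])

theorem reduces_R40 : Reduces (K := K) (n := 4) (p := 4)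
    (Ideal.span {X 0 ^ 2, X 1 ^ 2 + X 2 ^ 2, X 1 ^ 2 + X 3 ^ 2, X 0 * X 1, X 0 * X 2, X 0 * X 3,
      X 1 * X 2, X 1 * X 3, X 2 * X 3}) (X 1 ^ 2) (Ideal.span {X 0, X 1, X 2, X 3} ^ 2) :=
  .of_converts rfl (span_four_sq _ _ _ _) X X
    -- Both `z ^ 2` and `w ^ 2` equal `-y ^ 2` in the quotient, so each enters with the opposite
    -- sign.
    (coeffAt ![0, 2, 0, 0] - coeffAt ![0, 0, 2, 0] - coeffAt ![0, 0, 0, 2])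

theorem reduces_R41 : Reduces (K := K) (n := 4) (p := 4)
    (Ideal.span {X 0 ^ 2, X 1 ^ 2, X 2 ^ 2, X 3 ^ 2, X 0 * X 1 - X 2 * X 3, X 0 * X 2, X 0 * X 3,
      X 1 * X 2, X 1 * X 3}) (X 0 * X 1) (Ideal.span {X 0, X 1, X 2, X 3} ^ 2) :=
  .of_converts rfl (span_four_sq _ _ _ _) X X
    -- The relation is a difference here, so the coefficients are added.
    (coeffAt ![1, 1, 0, 0] + coeffAt ![0, 0, 1, 1])

theorem reduces_R41s : Reduces (K := K) (n := 4) (p := 4)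
    (Ideal.span {X 0 ^ 2 + X 1 ^ 2, X 0 ^ 2 + X 2 ^ 2, X 0 ^ 2 + X 3 ^ 2, X 0 * X 1, X 0 * X 2,
      X 0 * X 3, X 1 * X 2, X 1 * X 3, X 2 * X 3}) (X 0 ^ 2) (Ideal.span {X 0, X 1, X 2,
      X 3} ^ 2) :=
  .of_converts rfl (span_four_sq _ _ _ _) X X
    (coeffAt ![2, 0, 0, 0] - coeffAt ![0, 2, 0, 0] - coeffAt ![0, 0, 2, 0] - coeffAt ![0, 0, 0,
      2])

theorem reduces_R42 : Reduces (K := K) (n := 5) (p := 4)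
    (Ideal.span {X 0, X 1, X 2, X 3, X 4} ^ 2) (X 4) (Ideal.span {X 0, X 1, X 2, X 3} ^ 2) :=
  .of_converts (span_five_sq _ _ _ _ _) (span_four_sq _ _ _ _) ![X 0, X 1, X 2, X 3, 0] ![X 0,
      X 1, X 2, X 3]
    (coeffAt ![0, 0, 0, 0, 1])
end Rows

/-! ### Assembling the rows and targets -/

/-- The ideal `I` is the kernel of the surjection `R → R ⧸ I ≃ S`, that is, the preimage of the zero
ideal. -/
theorem losing_of_quotientEquiv {R S : Type*} [CommRing R] [CommRing S] {I : Ideal R}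
    (e : (R ⧸ I) ≃+* S) (h : Losing (⊥ : Ideal S)) : Losing I := by
  let f : R →+* S := e.toRingHom.comp (Ideal.Quotient.mk I)
  have hf : Function.Surjective f := e.surjective.comp Ideal.Quotient.mk_surjective
  have hker : (⊥ : Ideal S).comap f = I := by
    ext a
    change e (Ideal.Quotient.mk I a) = 0 ↔ a ∈ I
    rw [map_eq_zero_iff e e.injective, Ideal.Quotient.eq_zero_iff_mem]
  rw [← hker]
  exact h.comap f hf

theorem exists_reduces (K : Type*) [Field K] (i : AlgName)
    (hi : i ∉ ({.R1, .R4, .R12, .R13, .R17} : Set AlgName)) :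
    ∃ (m : Poly K i) (j : AlgName), (table K i).reduction = some (m, j) ∧
      j ∈ ({.R1, .R4, .R12, .R13, .R17} : Set AlgName) ∧
      Reduces (table K i).ideal m (table K j).ideal := by
  cases i with
  | R1 => exact absurd (by simp) hi
  | R2 => exact ⟨_, _, rfl, by simp, reduces_R2 K⟩
  | R3 => exact ⟨_, _, rfl, by simp, reduces_R3 K⟩
  | R4 => exact absurd (by simp) hi
  | R5 => exact ⟨_, _, rfl, by simp, reduces_R5 K⟩
  | R6 => exact ⟨_, _, rfl, by simp, reduces_R6 K⟩
  | R7 => exact ⟨_, _, rfl, by simp, reduces_R7 K⟩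
  | R7s => exact ⟨_, _, rfl, by simp, reduces_R7s K⟩
  | R8 => exact ⟨_, _, rfl, by simp, reduces_R8 K⟩
  | R9 => exact ⟨_, _, rfl, by simp, reduces_R9 K⟩
  | R10 => exact ⟨_, _, rfl, by simp, reduces_R10 K⟩
  | R11 => exact ⟨_, _, rfl, by simp, reduces_R11 K⟩
  | R12 => exact absurd (by simp) hi
  | R13 => exact absurd (by simp) hi
  | R14 => exact ⟨_, _, rfl, by simp, reduces_R14 K⟩
  | R15 => exact ⟨_, _, rfl, by simp, reduces_R15 K⟩
  | R15s => exact ⟨_, _, rfl, by simp, reduces_R15s K⟩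
  | R16 => exact ⟨_, _, rfl, by simp, reduces_R16 K⟩
  | R17 => exact absurd (by simp) hi
  | R18 => exact ⟨_, _, rfl, by simp, reduces_R18 K⟩
  | R19 => exact ⟨_, _, rfl, by simp, reduces_R19 K⟩
  | R20 => exact ⟨_, _, rfl, by simp, reduces_R20 K⟩
  | R21 => exact ⟨_, _, rfl, by simp, reduces_R21 K⟩
  | R22 => exact ⟨_, _, rfl, by simp, reduces_R22 K⟩
  | R23 => exact ⟨_, _, rfl, by simp, reduces_R23 K⟩
  | R24 => exact ⟨_, _, rfl, by simp, reduces_R24 K⟩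
  | R25 => exact ⟨_, _, rfl, by simp, reduces_R25 K⟩
  | R25s => exact ⟨_, _, rfl, by simp, reduces_R25s K⟩
  | R25ss => exact ⟨_, _, rfl, by simp, reduces_R25ss K⟩
  | R26 => exact ⟨_, _, rfl, by simp, reduces_R26 K⟩
  | R27 => exact ⟨_, _, rfl, by simp, reduces_R27 K⟩
  | R28 => exact ⟨_, _, rfl, by simp, reduces_R28 K⟩
  | R29 => exact ⟨_, _, rfl, by simp, reduces_R29 K⟩
  | R29s => exact ⟨_, _, rfl, by simp, reduces_R29s K⟩
  | R30 => exact ⟨_, _, rfl, by simp, reduces_R30 K⟩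
  | R31 => exact ⟨_, _, rfl, by simp, reduces_R31 K⟩
  | R31s => exact ⟨_, _, rfl, by simp, reduces_R31s K⟩
  | R32 => exact ⟨_, _, rfl, by simp, reduces_R32 K⟩
  | R33 => exact ⟨_, _, rfl, by simp, reduces_R33 K⟩
  | R34 => exact ⟨_, _, rfl, by simp, reduces_R34 K⟩
  | R34s => exact ⟨_, _, rfl, by simp, reduces_R34s K⟩
  | R35 => exact ⟨_, _, rfl, by simp, reduces_R35 K⟩
  | R36 => exact ⟨_, _, rfl, by simp, reduces_R36 K⟩
  | R36s => exact ⟨_, _, rfl, by simp, reduces_R36s K⟩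
  | R37 => exact ⟨_, _, rfl, by simp, reduces_R37 K⟩
  | R37s => exact ⟨_, _, rfl, by simp, reduces_R37s K⟩
  | R38 => exact ⟨_, _, rfl, by simp, reduces_R38 K⟩
  | R39 => exact ⟨_, _, rfl, by simp, reduces_R39 K⟩
  | R39s => exact ⟨_, _, rfl, by simp, reduces_R39s K⟩
  | R40 => exact ⟨_, _, rfl, by simp, reduces_R40 K⟩
  | R41 => exact ⟨_, _, rfl, by simp, reduces_R41 K⟩
  | R41s => exact ⟨_, _, rfl, by simp, reduces_R41s K⟩
  | R42 => exact ⟨_, _, rfl, by simp, reduces_R42 K⟩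

theorem losing_ideal_of_mem (K : Type*) [Field K] {j : AlgName}
    (hj : j ∈ ({.R1, .R4, .R12, .R13, .R17} : Set AlgName)) : Losing (table K j).ideal := by
  obtain rfl | rfl | rfl | rfl | rfl := hj
  exacts [losing_bot_zero K, losing_span_pair_sq K, losing_span_R12 K, losing_span_R13 K,
    losing_span_four_sq K]

end IdealChomp

open IdealChomp in
theorem mainTheorem3 (K : Type*) [Field K] (i : AlgName)
    (hi : i ∉ ({.R1, .R4, .R12, .R13, .R17} : Set AlgName)) :
    HasWinningStrategy .A (Alg K i) ∧
    ∃ (m : Poly K i) (j : AlgName), (table K i).reduction = some (m, j) ∧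
      j ∈ ({.R1, .R4, .R12, .R13, .R17} : Set AlgName) ∧
      cls K i m ≠ 0 ∧
      Nonempty ((Alg K i ⧸ Ideal.span {cls K i m}) ≃ₐ[K] Alg K j) ∧
      HasWinningStrategy .B (Alg K j) ∧
      ∃ σ : List (Alg K i) → Alg K i, IsWinningStrategy .A σ ∧ σ [] = cls K i m := by
  obtain ⟨m, j, hred, hj, hm, ⟨e⟩⟩ := exists_reduces K i hi
  have hne : cls K i m ≠ 0 := fun h => hm (Ideal.Quotient.eq_zero_iff_mem.1 h)
  have hbot : Losing (⊥ : Ideal (Alg K j)) := losing_bot_quotient (losing_ideal_of_mem K hj)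
  have hlos : Losing (Ideal.span {cls K i m}) := losing_of_quotientEquiv e.toRingEquiv hbot
  obtain ⟨σ, hσ, hσm⟩ := exists_winningStrategy_A hne hlos
  exact ⟨⟨σ, hσ⟩, m, j, hred, hj, hne, ⟨e⟩, hasWinningStrategy_B hbot, σ, hσ, hσm⟩
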